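/- **Conventions.** Virtual knot diagrams are taken up to detour moves, that is, as signed oriented Gauss codes. In Conway notation $1$, $-1$ are the two classical crossings (in $1$ the overpassing strand has positive slope) and $i$ is the virtual crossing; $a,b,\dots,c$ denotes the sum $a0+b0+\dots+c0$ of tangles, where $a0$ is the reflection of $a$ in the plane through its NW–SE line perpendicular to the diagram; the knot is the numerator closure. The virtual knot $KS=(((1,(i,1),-1),-1),i,1)$ has five classical crossings and Gauss code $U_a^+O_b^-O_a^+O_c^+U_d^-U_c^+O_e^-U_b^-U_e^-O_d^-$. The $Z$-move exchanges a classical crossing with the same crossing flanked by two virtual crossings; on Gauss codes it exchanges the over- and the under-passage of one crossing and keeps its sign. *$Z$-move equivalence* is the equivalence relation generated by the Reidemeister moves for virtual knots and the $Z$-move. A virtual knot is *classical* if it has a diagram without virtual crossings (equivalently, a Gauss code whose carrier surface is a sphere). A crossing is *odd* if an odd number of letters lies between its two occurrences in the Gauss code, otherwise *even*. A *parity state* $S$ replaces each odd crossing by a rigid 4-valent node and smooths each even crossing by its $A$- or $A^{-1}$-smoothing; $n(S)$ is the number of $A$-smoothings minus the number of $A^{-1}$-smoothings. The parity bracket is $\langle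 K\rangle_P=\sum_S A^{n(S)}[S]$, where $[\cdot]$ takes values in the $\mathbb Z[A,A^{-1}]$-module generated by virtual graphs with rigid 4-valent nodes (up to isomorphism), modulo the graphical second Reidemeister move (removing two nodes at the corners of a bigon), the graphical $Z$-move (reversing the cyclic order at a node), and $[G\sqcup\bigcirc]=(-A^2-A^{-2})[G]$. A graph with nodes is *irreducible* if no sequence of graphical $Z$-moves produces a bigon with two different nodes as corners. **Theorem.** 1. $KS$ has Jones polynomial $1$. 2. The parity bracket is invariant under the $Z$-move: if two diagrams of virtual knots differ by a $Z$-move, they have the same parity bracket. 3. $KS$ has one even and four odd crossings. The state with the $A$-smoothing of the even crossing reduces, by graphical second Reidemeister moves and $Z$-moves, to a single loop without nodes. The state $G$ with the $A^{-1}$-smoothing has four nodes and no free loop and is irreducible, even when graphical $Z$-moves are allowed. Hence $$\langle KS\rangle_P=A(-A^2-A^{-2})[\varnothing]+A^{-1}[G].$$ 4. $KS$ is not $Z$-move equivalent to any classical knot; in particular it is not $Z$-move equivalent to the unknot. 5. Hence the Fenn–Kauffman–Manturov $Z$-move conjecture, that every virtual knot with unit Jones polynomial is $Z$-move equivalent to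 the unknot, is false. -/

import Mathlib

open scoped LaurentPolynomial

/-! ### Virtual knots as Gauss codes

A virtual knot diagram is recorded by its oriented signed Gauss code: walking once around the knot,
one writes down every *classical* crossing that is met, whether one passes over or under, and the
sign of the crossing. Virtual crossings leave no trace, which builds in the detour move (that is,
all moves that involve virtual crossings only, or one classical and otherwise virtual crossings). -/

/-- One passage through a classical crossing: its label, whether it is the over-passage, and
whether the crossing is positive. -/
structure GaussLetter where
  label : ℕ
  isOver : Bool
  pos : Bool
deriving DecidableEq

/-- Every label that occurs, occurs exactly twice: once over, once under, with the same sign. -/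
def IsGaussCode (w : List GaussLetter) : Prop :=
  w.Nodup ∧ ∀ x ∈ w, (⟨x.label, !x.isOver, x.pos⟩ : GaussLetter) ∈ w ∧
    (⟨x.label, x.isOver, !x.pos⟩ : GaussLetter) ∉ w

instance (w : List GaussLetter) : Decidable (IsGaussCode w) := by
  unfold IsGaussCode; infer_instance

/-- A virtual knot diagram (one component), up to detour moves. -/
structure VirtualKnotDiagram where
  word : List GaussLetter
  valid : IsGaussCode word

/-- The crossingless diagram. -/
def unknotDiagram : VirtualKnotDiagram := ⟨[], by decide⟩

/-- `[x, y]`, or `[y, x]` if `swapped`. -/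
def orderedPair (swapped : Bool) (x y : GaussLetter) : List GaussLetter :=
  if swapped then [y, x] else [x, y]

/-- The virtualization of the crossing `a` on Gauss codes: the crossing is flanked by two virtual
crossings, which exchanges its over- and under-passage and keeps its sign. -/
def zWord (a : ℕ) (w : List GaussLetter) : List GaussLetter :=
  w.map fun x => if x.label = a then ⟨x.label, !x.isOver, x.pos⟩ else x

/-- Base point change, renaming of crossings, and the Reidemeister moves on Gauss codes.

In the third move `a`, `b`, `c` are the crossings of the top strand with the middle strand, of the
top strand with the bottom strand, and of the middle strand with the bottom strand, with signs
`ea`, `eb`, `ec`. If the strands have directions `t, m, b` in the plane, the sign of a crossing is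
that of `det (over, under)`; before the move the top strand meets `a` after `b` if and only if
`ea = eb`, the middle strand meets `a` after `c` if and only if `ea = ec`, and the bottom strand
meets `b` after `c` if and only if `eb = ec` (or all three orders are opposite), and the move
reverses all three orders. All sign choices occur, and the three strands can follow each other in
either cyclic order along the knot. -/
inductive ReidemeisterMove : List GaussLetter → List GaussLetter → Prop
  | rotate (u v : List GaussLetter) : ReidemeisterMove (u ++ v) (v ++ u)
  | rename (f : ℕ → ℕ) (hf : Function.Injective f) (w : List GaussLetter) :
      ReidemeisterMove w (w.map fun x => ⟨f x.label, x.isOver, x.pos⟩)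
  | one (u : List GaussLetter) (a : ℕ) (o s : Bool) :
      ReidemeisterMove u (u ++ [⟨a, o, s⟩, ⟨a, !o, s⟩])
  | two_parallel (u v : List GaussLetter) (a b : ℕ) (o s : Bool) :
      ReidemeisterMove (u ++ v)
        (u ++ [⟨a, o, s⟩, ⟨b, o, !s⟩] ++ v ++ [⟨a, !o, s⟩, ⟨b, !o, !s⟩])
  | two_antiparallel (u v : List GaussLetter) (a b : ℕ) (o s : Bool) :
      ReidemeisterMove (u ++ v)
        (u ++ [⟨a, o, s⟩, ⟨b, o, !s⟩] ++ v ++ [⟨b, !o, !s⟩, ⟨a, !o, s⟩])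
  | three_tmb (u v w : List GaussLetter) (a b c : ℕ) (ea eb ec : Bool) :
      ReidemeisterMove
        (orderedPair (ea == eb) ⟨a, true, ea⟩ ⟨b, true, eb⟩ ++ u ++
          orderedPair (ea == ec) ⟨a, false, ea⟩ ⟨c, true, ec⟩ ++ v ++
          orderedPair (eb == ec) ⟨b, false, eb⟩ ⟨c, false, ec⟩ ++ w)
        (orderedPair (ea != eb) ⟨a, true, ea⟩ ⟨b, true, eb⟩ ++ u ++
          orderedPair (ea != ec) ⟨a, false, ea⟩ ⟨c, true, ec⟩ ++ v ++
          orderedPair (eb != ec) ⟨b, false, eb⟩ ⟨c, false, ec⟩ ++ w)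
  | three_tbm (u v w : List GaussLetter) (a b c : ℕ) (ea eb ec : Bool) :
      ReidemeisterMove
        (orderedPair (ea == eb) ⟨a, true, ea⟩ ⟨b, true, eb⟩ ++ u ++
          orderedPair (eb == ec) ⟨b, false, eb⟩ ⟨c, false, ec⟩ ++ v ++
          orderedPair (ea == ec) ⟨a, false, ea⟩ ⟨c, true, ec⟩ ++ w)
        (orderedPair (ea != eb) ⟨a, true, ea⟩ ⟨b, true, eb⟩ ++ u ++
          orderedPair (eb != ec) ⟨b, false, eb⟩ ⟨c, false, ec⟩ ++ v ++
          orderedPair (ea != ec) ⟨a, false, ea⟩ ⟨c, true, ec⟩ ++ w)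

/-- A Reidemeister move between virtual knot diagrams. -/
def VirtualKnotDiagram.RMove (K K' : VirtualKnotDiagram) : Prop :=
  ReidemeisterMove K.word K'.word

/-- A `Z`-move between virtual knot diagrams. -/
def VirtualKnotDiagram.ZMove (K K' : VirtualKnotDiagram) : Prop :=
  ∃ a : ℕ, K'.word = zWord a K.word

/-- `Z`-move equivalence: the equivalence relation generated by the Reidemeister moves for virtual
knots and the `Z`-moves. -/
def ZMoveEquivalent : VirtualKnotDiagram → VirtualKnotDiagram → Prop :=
  Relation.EqvGen fun K K' => K.RMove K' ∨ K.ZMove K'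

/-! ### Arcs and slots

The knot is cut at the base point. A code with `N` letters then has the arcs `0, …, N`; the
letter at position `k` (counted from `0`) has incoming arc `k` and outgoing arc `k + 1`, and the
arcs `0` and `N` are glued at the base point whenever arcs are used. -/

/-- The labels of the classical crossings. -/
def crossings (w : List GaussLetter) : Finset ℕ := (w.map GaussLetter.label).toFinset

/-- The position of the over-passage (`o = true`) or under-passage (`o = false`) of `a`. -/
def position (w : List GaussLetter) (a : ℕ) (o : Bool) : ℕ :=
  w.findIdx fun x => x.label == a && x.isOver == o

/-- Whether the crossing `a` is positive. -/
def isPositive (w : List GaussLetter) (a : ℕ) : Bool := w.contains ⟨a, true, true⟩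

/-- The arcs at the four slots of the crossing `a`, in counterclockwise order, beginning with the
incoming arc of the over-strand if `a` is positive and of the under-strand if `a` is negative. -/
def slotArc (w : List GaussLetter) (a : ℕ) (s : Fin 4) : Fin (w.length + 1) :=
  let p := position w a (isPositive w a)
  let q := position w a (!isPositive w a)
  Fin.ofNat (w.length + 1) (![p, q, p + 1, q + 1] s)

/-- The sum of the signs of the crossings. -/
def writhe (w : List GaussLetter) : ℤ :=
  ∑ a ∈ crossings w, if isPositive w a then 1 else -1

/-- The slots of `a` that are joined by the `A`-smoothing (`A = true`), respectively by the
`A⁻¹`-smoothing. The `A`-smoothing joins the two regions that the over-strand sweeps when it is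
turned counterclockwise; it respects the orientation if and only if the crossing is positive. -/
def smoothingPairs (w : List GaussLetter) (a : ℕ) (A : Bool) : List (Fin 4 × Fin 4) :=
  if isPositive w a == A then [(0, 3), (1, 2)] else [(0, 1), (2, 3)]

/-- Two arcs are directly joined, after the crossings in `S` have been smoothed, those in `T` by
the `A`-smoothing and the others by the `A⁻¹`-smoothing. -/
def joined (w : List GaussLetter) (S T : Finset ℕ) (x y : Fin (w.length + 1)) : Prop :=
  (x = 0 ∧ y = Fin.last w.length) ∨
    ∃ a ∈ S, ∃ p ∈ smoothingPairs w a (decide (a ∈ T)), x = slotArc w a p.1 ∧ y = slotArc w a p.2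

/-- The connected pieces of the arcs after the smoothing. -/
abbrev StateArc (w : List GaussLetter) (S T : Finset ℕ) : Type := Quot (joined w S T)

/-! ### Kauffman bracket and Jones polynomial -/

/-- The loop value `-A² - A⁻²`. -/
noncomputable def loopValue : ℤ[T;T⁻¹] := -LaurentPolynomial.T 2 - LaurentPolynomial.T (-2)

/-- The Kauffman bracket polynomial in `A`, with value `1` on a single loop. -/
noncomputable def kauffmanBracket (K : VirtualKnotDiagram) : ℤ[T;T⁻¹] :=
  ∑ T ∈ (crossings K.word).powerset,
    LaurentPolynomial.T (2 * (T.card : ℤ) - ((crossings K.word).card : ℤ)) *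
      loopValue ^ (Nat.card (StateArc K.word (crossings K.word) T) - 1)

/-- The Jones polynomial, as a Laurent polynomial in `t^(1/4)`: the normalized bracket
`(-A³)^(-writhe) ⟨K⟩` with `A = t^(-1/4)`. -/
noncomputable def jonesPolynomial (K : VirtualKnotDiagram) : ℤ[T;T⁻¹] :=
  LaurentPolynomial.invert
    ((-1) ^ (writhe K.word).natAbs * LaurentPolynomial.T (-3 * writhe K.word) * kauffmanBracket K)

/-! ### Classical knots -/

/-- Two sides of arcs (`true` is the left side) that lie on the same boundary curve of the ribbon
surface of the Gauss code, next to each other at the base point or at a corner of a crossing. -/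
def sideJoined (w : List GaussLetter) (x y : Fin (w.length + 1) × Bool) : Prop :=
  (∃ b, x = (0, b) ∧ y = (Fin.last w.length, b)) ∨
    ∃ a ∈ crossings w,
      (x = (slotArc w a 0, false) ∧ y = (slotArc w a 1, true)) ∨
      (x = (slotArc w a 1, false) ∧ y = (slotArc w a 2, false)) ∨
      (x = (slotArc w a 2, true) ∧ y = (slotArc w a 3, false)) ∨
      (x = (slotArc w a 3, true) ∧ y = (slotArc w a 0, true))

/-- The number of faces of the diagram on its carrier surface. -/
noncomputable def faceCount (w : List GaussLetter) : ℕ := Nat.card (Quot (sideJoined w))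

/-- The diagram can be drawn on the sphere without virtual crossings: the carrier surface, with
`n` vertices, `2 n` edges and the faces, has Euler characteristic `2`. -/
def VirtualKnotDiagram.IsClassical (K : VirtualKnotDiagram) : Prop :=
  faceCount K.word = (crossings K.word).card + 2

/-! ### Virtual graphs with rigid 4-valent nodes -/

/-- A graph with 4-valent nodes, the four slots of every node being in counterclockwise order,
taken up to detour moves. `inc v s` is the edge at slot `s` of `v`; an edge without a node is a
free loop. -/
structure NodeGraph where
  V : Type
  E : Type
  finV : Finite V
  finE : Finite E
  inc : V → Fin 4 → E

namespace NodeGraph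

/-- Every edge has two ends at nodes, or is a free loop. -/
def IsFourValent (G : NodeGraph) : Prop :=
  ∀ e : G.E, Nat.card {p : G.V × Fin 4 // G.inc p.1 p.2 = e} = 0 ∨
    Nat.card {p : G.V × Fin 4 // G.inc p.1 p.2 = e} = 2

/-- Isomorphism that preserves the cyclic order at the nodes. -/
def Iso (G H : NodeGraph) : Prop :=
  ∃ (f : G.V ≃ H.V) (g : G.E ≃ H.E) (r : G.V → Fin 4),
    ∀ v s, H.inc (f v) (s + r v) = g (G.inc v s)

open Classical in
/-- The graphical `Z`-move: the node `v` is flanked by two virtual crossings, which reverses the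
cyclic order at `v`. -/
noncomputable def zFlip (G : NodeGraph) (v : G.V) : NodeGraph where
  V := G.V
  E := G.E
  finV := G.finV
  finE := G.finE
  inc := fun x s => if x = v then G.inc x (-s) else G.inc x s

/-- Equality up to isomorphism or one graphical `Z`-move. -/
def ZStep (G H : NodeGraph) : Prop := G.Iso H ∨ ∃ v, H = G.zFlip v

/-- Two different nodes are opposite corners of a bigon. -/
def Bigon (G : NodeGraph) (u v : G.V) : Prop :=
  u ≠ v ∧ ∃ i j : Fin 4, G.inc u i = G.inc v (j + 1) ∧ G.inc u (i + 1) = G.inc v j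

/-- The nodes `u` and `v` are removed: the two strands through each of them continue straight. -/
def removeNodes (G : NodeGraph) (u v : G.V) : NodeGraph where
  V := {x : G.V // x ≠ u ∧ x ≠ v}
  E := Quot fun e e' : G.E => ∃ x, (x = u ∨ x = v) ∧ ∃ s, e = G.inc x s ∧ e' = G.inc x (s + 2)
  finV := by have := G.finV; infer_instance
  finE := by have := G.finE; infer_instance
  inc := fun x s => Quot.mk _ (G.inc x.1 s)

/-- The graphical second Reidemeister move, as a reduction. -/
def TwoStep (G H : NodeGraph) : Prop :=
  G.IsFourValent ∧ ∃ u v, G.Bigon u v ∧ H = G.removeNodes u v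

/-- Reduction by graphical second Reidemeister moves, with graphical `Z`-moves allowed. -/
def ReducesTo : NodeGraph → NodeGraph → Prop :=
  Relation.ReflTransGen fun G H => G.ZStep H ∨ G.TwoStep H

/-- A graph that contains nodes, and in which no bigon arises by graphical `Z`-moves. -/
def IsIrreducible (G : NodeGraph) : Prop :=
  G.IsFourValent ∧ Nonempty G.V ∧
    ∀ H, Relation.ReflTransGen ZStep G H → ¬ ∃ u v, H.Bigon u v

/-- The graph without nodes and free loops. -/
def empty : NodeGraph where
  V := Empty
  E := Empty
  finV := inferInstance
  finE := inferInstance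
  inc := fun v => v.elim

/-- Disjoint union with a free loop. -/
def addLoop (G : NodeGraph) : NodeGraph where
  V := G.V
  E := Option G.E
  finV := G.finV
  finE := by have := G.finE; infer_instance
  inc := fun v s => some (G.inc v s)

/-- The number of free loops. -/
noncomputable def freeLoopCount (G : NodeGraph) : ℕ := Nat.card {e : G.E // ∀ v s, G.inc v s ≠ e}

end NodeGraph

/-! ### The parity bracket with graphical `Z`-moves -/

/-- The relations between graphs: isomorphic graphs, graphs related by a graphical `Z`-move or a
graphical second Reidemeister move are equal, and a free loop has the value `-A² - A⁻²`. -/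
noncomputable def graphRelations : Submodule ℤ[T;T⁻¹] (NodeGraph →₀ ℤ[T;T⁻¹]) :=
  Submodule.span ℤ[T;T⁻¹]
    ({x | ∃ G H : NodeGraph, (G.ZStep H ∨ G.TwoStep H) ∧
        x = Finsupp.single G 1 - Finsupp.single H 1} ∪
      {x | ∃ G : NodeGraph, x = Finsupp.single G.addLoop 1 - Finsupp.single G loopValue})

/-- The module in which the parity bracket takes its values. -/
abbrev GraphModule : Type 1 := (NodeGraph →₀ ℤ[T;T⁻¹]) ⧸ graphRelations

/-- The evaluation `[G]` of a graph. -/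
noncomputable def graphClass (G : NodeGraph) : GraphModule :=
  Submodule.Quotient.mk (Finsupp.single G 1)

/-- A crossing is odd if an odd number of letters lies between its two passages. -/
def IsOddCrossing (w : List GaussLetter) (a : ℕ) : Prop :=
  Odd (max (position w a true) (position w a false) -
    min (position w a true) (position w a false) - 1)

instance (w : List GaussLetter) : DecidablePred (IsOddCrossing w) := fun a => by
  unfold IsOddCrossing; infer_instance

def oddCrossings (w : List GaussLetter) : Finset ℕ := (crossings w).filter (IsOddCrossing w)

def evenCrossings (w : List GaussLetter) : Finset ℕ :=
  (crossings w).filter fun a => ¬ IsOddCrossing w a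

/-- The parity state: every odd crossing becomes a node, every even crossing is smoothed, those in
`T` by the `A`-smoothing and the others by the `A⁻¹`-smoothing. -/
def parityState (w : List GaussLetter) (T : Finset ℕ) : NodeGraph where
  V := {a : ℕ // a ∈ oddCrossings w}
  E := StateArc w (evenCrossings w) T
  finV := inferInstance
  finE := inferInstance
  inc := fun a s => Quot.mk _ (slotArc w a.1 s)

/-- The parity bracket, with graphical `Z`-moves among the graphical reductions. -/
noncomputable def parityBracket (K : VirtualKnotDiagram) : GraphModule :=
  ∑ T ∈ (evenCrossings K.word).powerset,
    (LaurentPolynomial.T (2 * (T.card : ℤ) - ((evenCrossings K.word).card : ℤ)) : ℤ[T;T⁻¹]) •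
      graphClass (parityState K.word T)

/-! ### Extended Conway notation -/

/-- The elementary tangles `1`, `-1`, `i`. -/
inductive CrossingKind
  | plus
  | minus
  | virtual
deriving DecidableEq

/-- A planar tangle diagram made of elementary tangles. A slot is a pair of a crossing (a position
in `kinds`) and a corner; the corners are `0, 1, 2, 3` = NW, SW, SE, NE, in counterclockwise order.
In the tangle `1` the overpassing strand runs from SW to NE, in `-1` from NW to SE. `glue` lists
the pairs of connected slots, and `ends` gives the slots at the four ends NW, SW, SE, NE. -/
structure ConwayTangle where
  kinds : List CrossingKind
  glue : List ((ℕ × Fin 4) × (ℕ × Fin 4))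
  ends : Fin 4 → ℕ × Fin 4

namespace ConwayTangle

def single (k : CrossingKind) : ConwayTangle := ⟨[k], [], fun s => (0, s)⟩

/-- Reflection of a tangle in the plane through its NW-SE line perpendicular to the plane of the
diagram (the operation `a ↦ a 0`). The elementary tangles are invariant under it. -/
def reflect (t : ConwayTangle) : ConwayTangle :=
  ⟨t.kinds, t.glue.map fun g => ((g.1.1, -g.1.2), (g.2.1, -g.2.2)),
    fun s => ((t.ends (-s)).1, -(t.ends (-s)).2)⟩

/-- The tangle sum: `u` is placed to the right of `t`. -/
def add (t u : ConwayTangle) : ConwayTangle :=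
  let sh : ℕ × Fin 4 → ℕ × Fin 4 := fun x => (x.1 + t.kinds.length, x.2)
  ⟨t.kinds ++ u.kinds,
    t.glue ++ u.glue.map (fun g => (sh g.1, sh g.2)) ++
      [(t.ends 3, sh (u.ends 0)), (t.ends 2, sh (u.ends 1))],
    ![t.ends 0, t.ends 1, sh (u.ends 2), sh (u.ends 3)]⟩

/-- Ramification `a, b, …, c`, the sum of the reflected tangles `a 0 + b 0 + ⋯ + c 0`. -/
def ramify (a : ConwayTangle) (l : List ConwayTangle) : ConwayTangle :=
  l.foldl (fun t b => t.add b.reflect) a.reflect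

/-- The glued pairs of slots of the numerator closure, which connects NW with NE and SW with SE. -/
def closureGlue (t : ConwayTangle) : List ((ℕ × Fin 4) × (ℕ × Fin 4)) :=
  t.glue ++ [(t.ends 0, t.ends 3), (t.ends 1, t.ends 2)]

/-- The slot that is glued to `x` in the numerator closure. -/
def partner (t : ConwayTangle) (x : ℕ × Fin 4) : ℕ × Fin 4 :=
  ((t.closureGlue.flatMap fun g => [g, (g.2, g.1)]).lookup x).getD x

/-- The slots through which crossings (classical or virtual) are entered on one tour of the
numerator closure, straight through every crossing, from the NW corner of the first one. -/
def tour (t : ConwayTangle) : List (ℕ × Fin 4) :=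
  List.iterate (fun x => t.partner (x.1, x.2 + 2)) (0, 0) (2 * t.kinds.length)

/-- The Gauss letter of the passage that enters through the slot `x`, if the crossing is classical.
A crossing is positive if and only if the under-strand enters at the corner that follows, in
counterclockwise order, the corner at which the over-strand enters. -/
def letter (t : ConwayTangle) (x : ℕ × Fin 4) : Option GaussLetter :=
  let even : Fin 4 := if (x.1, 0) ∈ t.tour then 0 else 2
  let odd : Fin 4 := if (x.1, 1) ∈ t.tour then 1 else 3
  match t.kinds[x.1]? with
  | some .plus => some ⟨x.1, x.2 == 1 || x.2 == 3, even == odd + 1⟩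
  | some .minus => some ⟨x.1, x.2 == 0 || x.2 == 2, odd == even + 1⟩
  | _ => none

/-- The Gauss code of the numerator closure (if that is a knot). -/
def gaussCode (t : ConwayTangle) : List GaussLetter := t.tour.filterMap t.letter

end ConwayTangle

open ConwayTangle in
/-- The tangle `(((1,(i,1),-1),-1),i,1)`. -/
def tangleKS : ConwayTangle :=
  ramify
    (ramify
      (ramify (single .plus) [ramify (single .virtual) [single .plus], single .minus])
      [single .minus])
    [single .virtual, single .plus]

/-- The virtual knot `KS = (((1,(i,1),-1),-1),i,1)`. -/
def knotKS : VirtualKnotDiagram := ⟨tangleKS.gaussCode, by decide⟩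

/-!
That `KS` is not `Z`-move equivalent to a classical knot is shown by an invariant with values in
`ZMod 2` of the cyclic word of crossing labels alone, `GaussWord.smoothingInvariant`. Since the
word forgets signs and over/under information, the `Z`-move does not change it. Smoothing a
crossing `d` along the orientation yields two closed curves. If they cross an even number of times,
each curve has a number of self-crossings whose loops meet the other curve an odd number of times;
the product of these two numbers modulo `2` is the contribution of `d`, and the invariant is the
sum of all contributions. The contribution of a kink is zero, those of the two crossings of a bigon
are equal, and the other contributions do not change in a Reidemeister move, since the two curves
only undergo a homotopy (`smoothingInvariant_kink`, `smoothingInvariant_bigon`,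
`smoothingInvariant_triangle`).

For a diagram on the sphere every contribution vanishes, because two closed curves on the sphere
cross an even number of times. Here the sphere is only known through its number of faces; a
dimension count over `ZMod 2` shows that every cycle of arcs bounds a set of faces
(`VirtualKnotDiagram.IsClassical.exists_faceFunction`), and this gives the parity statement
(`VirtualKnotDiagram.IsClassical.crossingTerm_eq_zero`). The word of `KS` is `abacdcebed`. Its only
even crossing is `d`; the smoothing gives the curves `abac` and `cebe`, where the self-crossings
`a` and `e` are both odd, so that the invariant is `1`.

The statements on the Jones polynomial, on the two parity states and on the value of the parity
bracket are finite computations: the classes of arcs of a state are computed by merging labels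
(`mergeLabels`, `natCard_quot`), and states are compared with explicit tables
(`NodeGraph.iso_ofInc`). Irreducibility follows from a condition on the pairs of opposite slots
alone, which graphical `Z`-moves preserve (`NodeGraph.HasNoFramedBigon`). The parity bracket is
invariant under the `Z`-move because a virtualization reverses the cyclic order of the slots
(`slotArc_zWord`). This reversal preserves both smoothings of an even crossing and is a graphical
`Z`-move at an odd one.
-/

/-! ### Gauss words and smoothings -/

namespace GaussWord

/-- The knot is smoothed at the crossing `d` along its orientation, which leaves two closed curves.
`half d b w` lists the letters of one of them: the state `b` is toggled at every letter `d`, and a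
letter is kept if the state is `true` when it is met. The letters `d` are dropped. -/
def half (d : ℕ) : Bool → List ℕ → List ℕ
  | _, [] => []
  | b, x :: w => if x = d then half d (!b) w else if b then x :: half d b w else half d b w

/-- The indicator of the crossings of the curve `y` with the curve `z`. -/
def mixed (y z : List ℕ) (x : ℕ) : ZMod 2 := if x ∈ y ∧ x ∈ z then 1 else 0

/-- Modulo `2`, the number of pairs of a letter with `m = 1` and a later letter with `m = 0`. If
`m` is `mixed`, this is the number of self-crossings of the curve whose loops meet the other curve
an odd number of times: the two passages of a self-crossing together contribute the number of mixed
letters between them. -/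
def precede (m : ℕ → ZMod 2) : List ℕ → ZMod 2
  | [] => 0
  | x :: l => m x * (l.map fun y => 1 + m y).sum + precede m l

/-- The contribution of the pair of curves `y`, `z`: if they cross an even number of times, the
product of their numbers of self-crossings whose loops meet the other curve an odd number of times.
-/
def splitTerm (y z : List ℕ) : ZMod 2 :=
  (1 + (y.map (mixed y z)).sum) * precede (mixed y z) y * precede (mixed y z) z

/-- The contribution of the pair of curves that arises from smoothing the crossing `d`. -/
def crossingTerm (w : List ℕ) (d : ℕ) : ZMod 2 := splitTerm (half d true w) (half d false w)

/-- The invariant of Gauss words that distinguishes `KS` from classical knots. -/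
def smoothingInvariant (w : List ℕ) : ZMod 2 := ∑ d ∈ w.toFinset, crossingTerm w d

/-- Every letter that occurs, occurs exactly twice. -/
def IsDoubleOccurrence (w : List ℕ) : Prop := ∀ x ∈ w, w.count x = 2

theorem half_append (d : ℕ) (b : Bool) (u v : List ℕ) :
    half d b (u ++ v) = half d b u ++ half d (b ^^ (u.count d).bodd) v := by
  induction u generalizing b with
  | nil => simp [half]
  | cons x u ih =>
    by_cases hx : x = d
    · subst hx; simp [half, ih, Nat.bodd_succ]
    · cases b <;> simp [half, ih, hx]

theorem half_of_notMem {d : ℕ} {u : List ℕ} (h : d ∉ u) (b : Bool) :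
    half d b u = if b then u else [] := by
  induction u with
  | nil => simp [half]
  | cons x u ih =>
    rw [List.mem_cons, not_or] at h
    have hx : x ≠ d := fun e => h.1 e.symm
    cases b <;> simp_all [half]

theorem half_subset (d : ℕ) (b : Bool) (w : List ℕ) : half d b w ⊆ w := by
  induction w generalizing b with
  | nil => simp [half]
  | cons x w ih =>
    intro t
    have h1 := @ih true t
    have h2 := @ih false t
    by_cases hx : x = d <;> cases b <;> simp [half, hx] <;> tauto

theorem self_notMem_half (d : ℕ) (b : Bool) (w : List ℕ) : d ∉ half d b w := by
  induction w generalizing b with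
  | nil => simp [half]
  | cons x w ih =>
    by_cases hx : x = d
    · simpa [half, hx] using ih _
    · cases b
      · simpa [half, hx] using ih _
      · simpa [half, hx, Ne.symm hx] using ih _

theorem count_half {d x : ℕ} (h : x ≠ d) (b : Bool) (w : List ℕ) :
    (half d b w).count x + (half d (!b) w).count x = w.count x := by
  induction w generalizing b with
  | nil => simp [half]
  | cons t w ih =>
    have h1 := ih b
    have h2 := ih (!b)
    by_cases ht : t = d
    · subst ht
      simp only [half, if_true, List.count_cons_of_ne (Ne.symm h)]
      exact h2
    · cases b <;> simp [half, ht, List.count_cons] at * <;> omega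

theorem map_half {f : ℕ → ℕ} (hf : Function.Injective f) (d : ℕ) (b : Bool) (w : List ℕ) :
    half (f d) b (w.map f) = (half d b w).map f := by
  induction w generalizing b with
  | nil => simp [half]
  | cons x w ih => cases b <;> by_cases hx : x = d <;> simp [half, hf.eq_iff, hx, ih]

theorem precede_append (m : ℕ → ZMod 2) (u v : List ℕ) :
    precede m (u ++ v) =
      precede m u + precede m v + (u.map m).sum * (v.map fun y => 1 + m y).sum := by
  induction u with
  | nil => simp [precede]
  | cons x u ih => simp [precede, ih]; ring

theorem precede_congr {m m' : ℕ → ZMod 2} {u : List ℕ} (h : ∀ x ∈ u, m x = m' x) :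
    precede m u = precede m' u := by
  induction u with
  | nil => rfl
  | cons x u ih =>
    have h' : ∀ y ∈ u, m y = m' y := fun y hy => h y (List.mem_cons_of_mem _ hy)
    have e : (u.map fun y => 1 + m y) = u.map fun y => 1 + m' y :=
      List.map_congr_left fun y hy => by rw [h' y hy]
    rw [precede, precede, ih h', h x List.mem_cons_self, e]

theorem precede_map (m : ℕ → ZMod 2) (f : ℕ → ℕ) (u : List ℕ) :
    precede m (u.map f) = precede (m ∘ f) u := by
  induction u with
  | nil => rfl
  | cons x u ih => simp [precede, ih, Function.comp_def]

/-- A sum over the letters of a word vanishes modulo `2` if every letter that contributes occurs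
an even number of times. -/
theorem sum_map_eq_zero {f : ℕ → ZMod 2} {l : List ℕ}
    (h : ∀ x ∈ l, f x = 0 ∨ Even (l.count x)) : (l.map f).sum = 0 := by
  rw [Finset.sum_list_map_count]
  refine Finset.sum_eq_zero fun x hx => ?_
  rcases h x (List.mem_toFinset.1 hx) with h | h
  · simp [h]
  · rw [nsmul_eq_mul, (ZMod.natCast_eq_zero_iff_even).2 h, zero_mul]

theorem mixed_comm (y z : List ℕ) : mixed y z = mixed z y := by
  funext x; simp [mixed, and_comm]

theorem IsDoubleOccurrence.of_perm {u v : List ℕ} (h : IsDoubleOccurrence u) (p : u.Perm v) :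
    IsDoubleOccurrence v := fun x hx => by
  rw [← p.count_eq, h x (p.mem_iff.2 hx)]

section Split

variable {y z : List ℕ} (h : IsDoubleOccurrence (y ++ z))
include h

theorem IsDoubleOccurrence.swap : IsDoubleOccurrence (z ++ y) :=
  h.of_perm List.perm_append_comm

theorem sum_self_eq_zero : (y.map fun x => 1 + mixed y z x).sum = 0 := by
  refine sum_map_eq_zero fun x hx => ?_
  by_cases hz : x ∈ z
  · left; rw [mixed, if_pos ⟨hx, hz⟩]; exact CharTwo.add_self_eq_zero 1
  · right
    have := h x (by simp [hx])
    rw [List.count_append, List.count_eq_zero_of_not_mem hz, add_zero] at this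
    rw [this]; decide

theorem sum_mixed_eq : (y.map (mixed y z)).sum = (z.map (mixed y z)).sum := by
  have := sum_map_eq_zero (f := mixed y z) (l := y ++ z)
    fun x hx => Or.inr (by rw [h x hx]; exact even_two)
  rw [List.map_append, List.sum_append] at this
  exact CharTwo.add_eq_zero.1 this

theorem splitTerm_comm : splitTerm y z = splitTerm z y := by
  rw [splitTerm, splitTerm, mixed_comm z y, sum_mixed_eq h]
  ring

end Split

/-- The contribution of a pair of closed curves does not depend on their base points. -/
theorem splitTerm_rotate {y z z' : List ℕ} (h : IsDoubleOccurrence (y ++ (z ++ z'))) :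
    splitTerm y (z ++ z') = splitTerm y (z' ++ z) := by
  have hm : mixed y (z' ++ z) = mixed y (z ++ z') := by funext x; simp [mixed, or_comm]
  have h1 := sum_self_eq_zero h.swap
  have h2 := sum_mixed_eq h
  rw [mixed_comm] at h1
  rw [splitTerm, splitTerm, hm, precede_append, precede_append]
  rw [List.map_append, List.sum_append] at h1 h2
  rw [h2]
  generalize ((List.map _ z).sum : ZMod 2) = p at *
  generalize ((List.map _ z').sum : ZMod 2) = q at *
  generalize ((List.map _ z).sum : ZMod 2) = r at *
  generalize ((List.map _ z').sum : ZMod 2) = s at *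
  generalize precede _ z = t
  generalize precede _ z' = t'
  generalize precede _ y = t''
  clear h2 hm
  revert p q r s t t' t''
  decide

theorem IsDoubleOccurrence.half {w : List ℕ} (h : IsDoubleOccurrence w) (d : ℕ) (b : Bool) :
    IsDoubleOccurrence (half d b w ++ half d (!b) w) := by
  intro x hx
  have hd : x ≠ d := by
    rintro rfl
    rcases List.mem_append.1 hx with hx | hx <;> exact self_notMem_half _ _ _ hx
  have hw : x ∈ w := by
    rcases List.mem_append.1 hx with hx | hx <;> exact half_subset _ _ _ hx
  rw [List.count_append, count_half hd, h x hw]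

/-- If the base point moves past an odd number of passages through `d`, the two curves are
exchanged. -/
theorem crossingTerm_rotate {u v : List ℕ} (h : IsDoubleOccurrence (u ++ v)) (d : ℕ)
    (hd : d ∈ u ++ v) : crossingTerm (u ++ v) d = crossingTerm (v ++ u) d := by
  have h1 := h.half d true
  have h2 := h _ hd
  rw [List.count_append] at h2
  have h3 : (u.count d).bodd = (v.count d).bodd := by
    have := congrArg Nat.bodd h2
    rw [Nat.bodd_add] at this
    cases hu : (u.count d).bodd <;> cases hv : (v.count d).bodd <;> simp_all
  have perm : ∀ p q r t : List ℕ, (p ++ q ++ (r ++ t)).Perm (q ++ p ++ (t ++ r)) := fun p q r t =>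
    List.perm_append_comm.append List.perm_append_comm
  simp only [crossingTerm, half_append, ← h3] at *
  cases hu : (u.count d).bodd <;> simp only [hu, Bool.xor_false, Bool.xor_true, Bool.not_true,
    Bool.not_false] at *
  · have h4 := h1.of_perm (List.perm_append_comm.append_left _)
    rw [splitTerm_rotate h1, splitTerm_comm h4, splitTerm_rotate h4.swap,
      ← splitTerm_comm (h1.of_perm (perm _ _ _ _))]
  · have h4 := h1.of_perm (List.perm_append_comm.append_left _)
    rw [splitTerm_rotate h1, splitTerm_comm h4, splitTerm_rotate h4.swap]

theorem smoothingInvariant_rotate {u v : List ℕ} (h : IsDoubleOccurrence (u ++ v)) :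
    smoothingInvariant (u ++ v) = smoothingInvariant (v ++ u) := by
  have e : (u ++ v).toFinset = (v ++ u).toFinset := by ext; simp [or_comm]
  rw [smoothingInvariant, smoothingInvariant, ← e]
  exact Finset.sum_congr rfl fun d hd => crossingTerm_rotate h d (List.mem_toFinset.1 hd)

theorem smoothingInvariant_map {f : ℕ → ℕ} (hf : Function.Injective f) (w : List ℕ) :
    smoothingInvariant (w.map f) = smoothingInvariant w := by
  have e : (w.map f).toFinset = w.toFinset.map ⟨f, hf⟩ := by ext; simp
  rw [smoothingInvariant, e, Finset.sum_map]
  refine Finset.sum_congr rfl fun d _ => ?_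
  have hm : ∀ y z : List ℕ, mixed (y.map f) (z.map f) ∘ f = mixed y z := fun y z => by
    funext x; simp [mixed, hf.eq_iff]
  simp [crossingTerm, map_half hf, splitTerm, precede_map, hm]

/-! ### Kinks and transpositions -/

theorem splitTerm_nil (y : List ℕ) : splitTerm y [] = 0 := by
  simp [splitTerm, precede]

theorem crossingTerm_of_kink {u : List ℕ} {a : ℕ} (ha : a ∉ u) :
    crossingTerm (u ++ [a, a]) a = 0 := by
  rw [crossingTerm, half_append, half_append]
  simp [half_of_notMem ha, half, splitTerm_nil]

theorem crossingTerm_kink_of_ne {u : List ℕ} {a d : ℕ} (ha : a ∉ u) (hd : a ≠ d) :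
    crossingTerm (u ++ [a, a]) d = crossingTerm u d := by
  have h0 : ∀ b, a ∉ half d b u := fun b h => ha (half_subset _ _ _ h)
  have hm : ∀ x, mixed (half d true (u ++ [a, a])) (half d false (u ++ [a, a])) x =
      mixed (half d true u) (half d false u) x := by
    intro x
    rw [half_append, half_append]
    cases (u.count d).bodd <;> simp [half, hd, mixed] <;>
      · by_cases hx : x = a
        · subst hx; simp [h0]
        · simp [hx]
  have ha' : mixed (half d true u) (half d false u) a = 0 := by simp [mixed, h0]
  rw [crossingTerm, splitTerm, funext hm, crossingTerm, splitTerm, half_append, half_append]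
  have two : (1 + 1 : ZMod 2) = 0 := by decide
  cases (u.count d).bodd <;> simp [half, hd, precede_append, precede, ha', two]

theorem smoothingInvariant_kink {u : List ℕ} {a : ℕ} (h : IsDoubleOccurrence (u ++ [a, a])) :
    smoothingInvariant (u ++ [a, a]) = smoothingInvariant u := by
  have ha : a ∉ u := by
    have h1 := h a (by simp)
    intro hu
    have := List.count_pos_iff.2 hu
    rw [List.count_append] at h1
    simp at h1
    omega
  have e : (u ++ [a, a]).toFinset = insert a u.toFinset := by ext; simp
  rw [smoothingInvariant, e, Finset.sum_insert (by simpa using ha), crossingTerm_of_kink ha,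
    zero_add]
  refine Finset.sum_congr rfl fun d hd => crossingTerm_kink_of_ne ha ?_
  rintro rfl
  exact ha (List.mem_toFinset.1 hd)

theorem precede_half_swap (m : ℕ → ZMod 2) {d p q : ℕ} (hp : p ≠ d) (hq : q ≠ d) (b : Bool)
    (u v : List ℕ) :
    precede m (half d b (u ++ q :: p :: v)) = precede m (half d b (u ++ p :: q :: v)) +
      if b ^^ (u.count d).bodd then m p + m q else 0 := by
  rw [half_append, half_append]
  cases b ^^ (u.count d).bodd
  · simp [half, hp, hq]
  · simp only [half, hp, hq, precede_append, precede, if_false, if_true, List.map_cons,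
      List.sum_cons]
    generalize m p = s
    generalize m q = t
    generalize ((List.map _ _).sum : ZMod 2) = k
    generalize ((List.map _ _).sum : ZMod 2) = k'
    generalize precede _ _ = r
    generalize precede _ _ = r'
    revert s t k k' r r'
    decide

theorem half_swap_perm {d p q : ℕ} (hp : p ≠ d) (hq : q ≠ d) (b : Bool) (u v : List ℕ) :
    (half d b (u ++ q :: p :: v)).Perm (half d b (u ++ p :: q :: v)) := by
  rw [half_append, half_append]
  refine List.Perm.append_left _ ?_
  cases b ^^ (u.count d).bodd <;> simp only [half, hp, hq, if_false, if_true]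
  · simp
  · exact List.Perm.swap _ _ _

theorem mixed_congr {y y' z z' : List ℕ} (hy : y.Perm y') (hz : z.Perm z') :
    mixed y z = mixed y' z' := by
  funext x; simp [mixed, hy.mem_iff, hz.mem_iff]

/-- A crossing is mixed after the smoothing of `d` if and only if it is interlaced with `d`. -/
theorem mixed_half {d x : ℕ} (hx : x ≠ d) {u v w : List ℕ} (hu : x ∉ u) (hv : x ∉ v)
    (hw : x ∉ w) :
    mixed (half d true (u ++ x :: v ++ x :: w)) (half d false (u ++ x :: v ++ x :: w)) x =
      if (v.count d).bodd then 1 else 0 := by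
  have h0 : ∀ b t, x ∉ t → x ∉ half d b t := fun b t ht h => ht (half_subset _ _ _ h)
  simp only [half_append, List.count_append, Nat.bodd_add, List.count_cons_of_ne hx, mixed]
  cases (u.count d).bodd <;> cases (v.count d).bodd <;> simp [half, hx, h0, hu, hv, hw]

/-! ### Bigons -/

theorem precede_half_twins {m : ℕ → ZMod 2} {d p q : ℕ} (hp : p ≠ d) (hq : q ≠ d)
    (hm : m p = m q) (b : Bool) (u v : List ℕ) :
    precede m (half d b (u ++ p :: q :: v)) = precede m (half d b (u ++ v)) := by
  rw [half_append, half_append]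
  cases b ^^ (u.count d).bodd
  · simp [half, hp, hq]
  · simp only [half, hp, hq, precede_append, precede, if_false, if_true, List.map_cons,
      List.sum_cons, hm]
    generalize m q = t
    generalize ((List.map _ _).sum : ZMod 2) = k
    generalize ((List.map _ _).sum : ZMod 2) = k'
    generalize precede _ _ = r
    generalize precede _ _ = r'
    revert t k k' r r'
    decide

theorem sum_half_twins {m : ℕ → ZMod 2} {d p q : ℕ} (hp : p ≠ d) (hq : q ≠ d)
    (hm : m p = m q) (b : Bool) (u v : List ℕ) :
    ((half d b (u ++ p :: q :: v)).map m).sum = ((half d b (u ++ v)).map m).sum := by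
  rw [half_append, half_append]
  cases b ^^ (u.count d).bodd
  · simp [half, hp, hq]
  · simp only [half, hp, hq, if_false, if_true, List.map_cons, List.map_append, List.sum_append,
      List.sum_cons, hm]
    rw [← add_assoc (m q), CharTwo.add_self_eq_zero, zero_add]

theorem mem_half_twins {d p q x : ℕ} (hp : p ≠ d) (hq : q ≠ d) (hxp : x ≠ p) (hxq : x ≠ q)
    (b : Bool) (u v : List ℕ) :
    x ∈ half d b (u ++ p :: q :: v) ↔ x ∈ half d b (u ++ v) := by
  rw [half_append, half_append]
  cases b ^^ (u.count d).bodd <;> simp [half, hp, hq, hxp, hxq]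

/-- The two crossings of a bigon do not affect the contributions of other crossings: they are both
mixed or both not, and they are adjacent at both passages. -/
theorem crossingTerm_twins {u v t : List ℕ} {a b d : ℕ} (ht : t = [a, b] ∨ t = [b, a])
    (ha : a ≠ d) (hb : b ≠ d) (hab : a ≠ b) (hau : a ∉ u) (hav : a ∉ v) (hbu : b ∉ u)
    (hbv : b ∉ v) : crossingTerm (u ++ a :: b :: v ++ t) d = crossingTerm (u ++ v) d := by
  set w := u ++ a :: b :: v ++ t with hw
  set m := mixed (half d true w) (half d false w) with hm
  have hmab : m a = m b := by
    have h1 : m a = if (v.count d).bodd then 1 else 0 := by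
      rcases ht with rfl | rfl
      · have := mixed_half ha (u := u) (v := b :: v) (w := [b]) hau (by simp [hab, hav])
          (by simp [hab])
        rw [List.count_cons_of_ne hb] at this
        simpa [hm, hw] using this
      · have := mixed_half ha (u := u) (v := b :: v ++ [b]) (w := []) hau (by simp [hab, hav])
          (by simp)
        rw [List.count_append, List.count_cons_of_ne hb, List.count_cons_of_ne hb] at this
        simpa [hm, hw] using this
    have h2 : m b = if (v.count d).bodd then 1 else 0 := by
      rcases ht with rfl | rfl
      · have := mixed_half hb (u := u ++ [a]) (v := v ++ [a]) (w := [])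
          (by simp [hbu, hab.symm]) (by simp [hab.symm, hbv]) (by simp)
        rw [List.count_append, List.count_cons_of_ne ha] at this
        simpa [hm, hw] using this
      · have := mixed_half hb (u := u ++ [a]) (v := v) (w := [a])
          (by simp [hbu, hab.symm]) hbv (by simp [hab.symm])
        simpa [hm, hw] using this
    rw [h1, h2]
  have hp : ∀ c, precede m (half d c w) = precede m (half d c (u ++ v)) := by
    intro c
    have h1 := precede_half_twins ha hb hmab c u (v ++ t)
    have h2 : precede m (half d c (u ++ v ++ t)) = precede m (half d c (u ++ v)) := by
      rcases ht with rfl | rfl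
      · simpa using precede_half_twins ha hb hmab c (u ++ v) []
      · simpa using precede_half_twins hb ha hmab.symm c (u ++ v) []
    rw [hw, ← h2, List.append_assoc, List.append_assoc, ← h1]
    simp
  have hs : ∀ c, ((half d c w).map m).sum = ((half d c (u ++ v)).map m).sum := by
    intro c
    have h1 := sum_half_twins ha hb hmab c u (v ++ t)
    have h2 : ((half d c (u ++ v ++ t)).map m).sum = ((half d c (u ++ v)).map m).sum := by
      rcases ht with rfl | rfl
      · simpa using sum_half_twins ha hb hmab c (u ++ v) []
      · simpa using sum_half_twins hb ha hmab.symm c (u ++ v) []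
    rw [hw, ← h2, List.append_assoc, List.append_assoc, ← h1]
    simp
  have hmem : ∀ c x, x ≠ a → x ≠ b → (x ∈ half d c w ↔ x ∈ half d c (u ++ v)) := by
    intro c x hxa hxb
    have h1 := mem_half_twins ha hb hxa hxb c u (v ++ t)
    have h2 : x ∈ half d c (u ++ v ++ t) ↔ x ∈ half d c (u ++ v) := by
      rcases ht with rfl | rfl
      · simpa using mem_half_twins ha hb hxa hxb c (u ++ v) []
      · simpa using mem_half_twins hb ha hxb hxa c (u ++ v) []
    rw [hw, ← h2, List.append_assoc, List.append_assoc, ← h1]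
    simp
  have hm' : ∀ c, ∀ x ∈ half d c (u ++ v),
      m x = mixed (half d true (u ++ v)) (half d false (u ++ v)) x := by
    intro c x hx
    have h1 := half_subset _ _ _ hx
    have hxa : x ≠ a := by rintro rfl; simp [hau, hav] at h1
    have hxb : x ≠ b := by rintro rfl; simp [hbu, hbv] at h1
    simp [hm, mixed, hmem _ x hxa hxb]
  rw [crossingTerm, splitTerm, ← hm, hp, hp, hs, crossingTerm, splitTerm,
    precede_congr (hm' true), precede_congr (hm' false), List.map_congr_left (hm' true)]

/-- Up to a kink, the smoothings of the two crossings of a bigon give the same curves, so that their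
contributions cancel modulo `2`. -/
theorem crossingTerm_bigon {u v t : List ℕ} {a b : ℕ} (ht : t = [a, b] ∨ t = [b, a])
    (hab : a ≠ b) (hau : a ∉ u) (hav : a ∉ v) (hbu : b ∉ u) (hbv : b ∉ v)
    (h : IsDoubleOccurrence (u ++ v)) :
    crossingTerm (u ++ a :: b :: v ++ t) a = crossingTerm (u ++ a :: b :: v ++ t) b := by
  have hu := sum_self_eq_zero h
  have hv := sum_self_eq_zero h.swap
  have hs := sum_mixed_eq h
  rw [mixed_comm] at hv
  have key : ∀ y z : List ℕ, (∀ x, x ≠ a → x ≠ b → (x ∈ y ↔ x ∈ u)) →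
      (∀ x, x ≠ a → x ≠ b → (x ∈ z ↔ x ∈ v)) →
      precede (mixed y z) u = precede (mixed u v) u ∧ precede (mixed y z) v = precede (mixed u v) v
      ∧ (u.map (mixed y z)).sum = (u.map (mixed u v)).sum
      ∧ (v.map (mixed y z)).sum = (v.map (mixed u v)).sum
      ∧ (u.map fun x => 1 + mixed y z x).sum = 0 ∧ (v.map fun x => 1 + mixed y z x).sum = 0 := by
    intro y z hy hz
    have h1 : ∀ x, x ∈ u ∨ x ∈ v → mixed y z x = mixed u v x := by
      intro x hx
      have hxa : x ≠ a := by rintro rfl; tauto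
      have hxb : x ≠ b := by rintro rfl; tauto
      simp [mixed, hy x hxa hxb, hz x hxa hxb]
    refine ⟨precede_congr fun x hx => h1 x (.inl hx), precede_congr fun x hx => h1 x (.inr hx),
      ?_, ?_, ?_, ?_⟩
    · rw [List.map_congr_left fun x hx => h1 x (.inl hx)]
    · rw [List.map_congr_left fun x hx => h1 x (.inr hx)]
    · rw [← hu, List.map_congr_left fun x hx => by rw [h1 x (.inl hx)]]
    · rw [← hv, List.map_congr_left fun x hx => by rw [h1 x (.inr hx)]]
  have two : (1 + 1 : ZMod 2) = 0 := by decide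
  rcases ht with rfl | rfl
  · obtain ⟨k1, k2, k3, k4, k5, k6⟩ := key (u ++ [b]) (b :: v)
      (by intro x _ h; simp [h]) (by intro x _ h; simp [h])
    obtain ⟨l1, l2, l3, l4, l5, l6⟩ := key (u ++ [a]) (v ++ [a])
      (by intro x h _; simp [h]) (by intro x h _; simp [h])
    have hb : mixed (u ++ [b]) (b :: v) b = 1 := by simp [mixed]
    have ha : mixed (u ++ [a]) (v ++ [a]) a = 1 := by simp [mixed]
    simp [crossingTerm, half_append, half_of_notMem, half, hab.symm,
      List.count_eq_zero_of_not_mem, splitTerm, precede_append, precede, *]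
  · obtain ⟨k1, k2, k3, k4, k5, k6⟩ := key u (b :: (v ++ [b]))
      (by intro x _ h; simp) (by intro x _ h; simp [h])
    obtain ⟨l1, l2, l3, l4, l5, l6⟩ := key (u ++ [a, a]) v
      (by intro x h _; simp [h]) (by intro x h _; simp)
    have hb : mixed u (b :: (v ++ [b])) b = 0 := by simp [mixed, hbu]
    have ha : mixed (u ++ [a, a]) v a = 0 := by simp [mixed, hav]
    simp [crossingTerm, half_append, half_of_notMem, half, hab.symm,
      List.count_eq_zero_of_not_mem, splitTerm, precede_append, precede, *]
    generalize ((List.map _ v).sum : ZMod 2) = s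
    generalize precede _ u = p
    clear * -
    revert p s
    decide

theorem smoothingInvariant_bigon {u v t : List ℕ} {a b : ℕ} (ht : t = [a, b] ∨ t = [b, a])
    (h : IsDoubleOccurrence (u ++ a :: b :: v ++ t)) :
    smoothingInvariant (u ++ a :: b :: v ++ t) = smoothingInvariant (u ++ v) := by
  have h1 := h a (by simp)
  have h2 := h b (by simp)
  have hab : a ≠ b := by
    rintro rfl
    rcases ht with rfl | rfl <;> simp at h1 <;> omega
  have h0 : a ∉ u ∧ a ∉ v ∧ b ∉ u ∧ b ∉ v := by
    simp only [← List.count_eq_zero]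
    rcases ht with rfl | rfl <;> simp [hab, hab.symm] at h1 h2 <;> omega
  obtain ⟨hau, hav, hbu, hbv⟩ := h0
  have huv : IsDoubleOccurrence (u ++ v) := by
    intro x hx
    have hxa : a ≠ x := by rintro rfl; simp [hau, hav] at hx
    have hxb : b ≠ x := by rintro rfl; simp [hbu, hbv] at hx
    have := h x (by simp at hx ⊢; tauto)
    rcases ht with rfl | rfl <;> simpa [List.count_cons, hxa, hxb] using this
  have e : (u ++ a :: b :: v ++ t).toFinset = insert a (insert b (u ++ v).toFinset) := by
    ext x; rcases ht with rfl | rfl <;> simp <;> tauto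
  rw [smoothingInvariant, e, Finset.sum_insert (by simp [hab, hau, hav]),
    Finset.sum_insert (by simp [hbu, hbv]), ← add_assoc,
    crossingTerm_bigon ht hab hau hav hbu hbv huv, CharTwo.add_self_eq_zero, zero_add]
  refine Finset.sum_congr rfl fun d hd => crossingTerm_twins ht ?_ ?_ hab hau hav hbu hbv
  · rintro rfl; simp [hau, hav] at hd
  · rintro rfl; simp [hbu, hbv] at hd

/-! ### Triangles -/

/-- The word `xy`, or `yx` if `s`. -/
def labelPair (s : Bool) (x y : ℕ) : List ℕ := if s then [y, x] else [x, y]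

theorem crossingTerm_congr {w w' : List ℕ} {d : ℕ} (ht : (half d true w).Perm (half d true w'))
    (hf : (half d false w).Perm (half d false w'))
    (h : ∀ b, precede (mixed (half d true w) (half d false w)) (half d b w) =
      precede (mixed (half d true w) (half d false w)) (half d b w')) :
    crossingTerm w d = crossingTerm w' d := by
  rw [crossingTerm, crossingTerm, splitTerm, splitTerm, ← mixed_congr ht hf, h, h,
    (ht.map _).sum_eq]

theorem half_labelPair_perm {d p q : ℕ} (hp : p ≠ d) (hq : q ≠ d) (b s : Bool) (u v : List ℕ) :
    (half d b (u ++ labelPair s p q ++ v)).Perm (half d b (u ++ labelPair (!s) p q ++ v)) := by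
  cases s
  · simpa [labelPair] using half_swap_perm hq hp b u v
  · simpa [labelPair] using half_swap_perm hp hq b u v

theorem precede_half_labelPair (m : ℕ → ZMod 2) {d p q : ℕ} (hp : p ≠ d) (hq : q ≠ d)
    (b s : Bool) (u v : List ℕ) :
    precede m (half d b (u ++ labelPair s p q ++ v)) =
      precede m (half d b (u ++ labelPair (!s) p q ++ v)) +
      if b ^^ (u.count d).bodd then m p + m q else 0 := by
  cases s
  · simpa [labelPair, add_comm] using precede_half_swap m hq hp b u v
  · simpa [labelPair] using precede_half_swap m hp hq b u v

theorem count_labelPair {d p q : ℕ} (hp : p ≠ d) (hq : q ≠ d) (s : Bool) :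
    (labelPair s p q).count d = 0 := by
  cases s <;> simp [labelPair, hp, hq]

theorem mem_half_labelPair {d p q x : ℕ} (hp : p ≠ d) (hq : q ≠ d) (b s : Bool) :
    x ∈ half d b (labelPair s p q) ↔ b = true ∧ (x = p ∨ x = q) := by
  cases b <;> cases s <;> simp [labelPair, half, hp, hq, or_comm]

theorem labelPair_comm (s : Bool) (x y : ℕ) : labelPair s x y = labelPair (!s) y x := by
  cases s <;> rfl

/-- Each of the three transpositions changes `precede`, on the curve where it takes place, by the
number of mixed letters that it moves. A crossing of two strands is mixed if and only if the strands
lie on different curves, so that the three changes cancel. -/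
theorem crossingTerm_triangle_of_ne {u v w : List ℕ} {a b c d : ℕ} (r s t : Bool)
    (ha : a ≠ d) (hb : b ≠ d) (hc : c ≠ d) (hab : a ≠ b) (hac : a ≠ c) (hbc : b ≠ c)
    (hu : a ∉ u ∧ b ∉ u ∧ c ∉ u) (hv : a ∉ v ∧ b ∉ v ∧ c ∉ v) (hw : a ∉ w ∧ b ∉ w ∧ c ∉ w) :
    crossingTerm (labelPair r a b ++ u ++ labelPair s a c ++ v ++ labelPair t b c ++ w) d =
      crossingTerm (labelPair (!r) a b ++ u ++ labelPair (!s) a c ++ v ++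
        labelPair (!t) b c ++ w) d := by
  have perm : ∀ x, (half d x
      (labelPair r a b ++ u ++ labelPair s a c ++ v ++ labelPair t b c ++ w)).Perm
      (half d x (labelPair (!r) a b ++ u ++ labelPair (!s) a c ++ v ++
        labelPair (!t) b c ++ w)) := fun x => by
    have h1 := half_labelPair_perm ha hb x r []
      (u ++ labelPair s a c ++ v ++ labelPair t b c ++ w)
    have h2 := half_labelPair_perm ha hc x s (labelPair (!r) a b ++ u)
      (v ++ labelPair t b c ++ w)
    have h3 := half_labelPair_perm hb hc x t (labelPair (!r) a b ++ u ++ labelPair (!s) a c ++ v) w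
    simp only [List.nil_append, List.append_assoc] at h1 h2 h3 ⊢
    exact (h1.trans h2).trans h3
  refine crossingTerm_congr (perm _) (perm _) fun x => ?_
  set W := labelPair r a b ++ u ++ labelPair s a c ++ v ++ labelPair t b c ++ w with hW
  set m := mixed (half d true W) (half d false W) with hm
  have h0 : ∀ x l, (a ∉ l ∧ b ∉ l ∧ c ∉ l) →
      a ∉ half d x l ∧ b ∉ half d x l ∧ c ∉ half d x l := fun x l h =>
    ⟨fun h' => h.1 (half_subset _ _ _ h'), fun h' => h.2.1 (half_subset _ _ _ h'),
      fun h' => h.2.2 (half_subset _ _ _ h')⟩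
  obtain ⟨hma, hmb, hmc⟩ : m a = (if (u.count d).bodd then 1 else 0) ∧
      m b = (if (u.count d).bodd ^^ (v.count d).bodd then 1 else 0) ∧
      m c = (if (v.count d).bodd then 1 else 0) := by
    simp only [hm, hW, mixed, half_append, List.count_append, Nat.bodd_add, List.mem_append,
      count_labelPair ha hb, count_labelPair ha hc, count_labelPair hb hc,
      mem_half_labelPair ha hb, mem_half_labelPair ha hc, mem_half_labelPair hb hc, h0 _ _ hu,
      h0 _ _ hv, h0 _ _ hw]
    cases (u.count d).bodd <;> cases (v.count d).bodd <;>
      simp [hab, hac, hbc, hab.symm, hac.symm, hbc.symm]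
  have h1 := precede_half_labelPair m ha hb x r []
    (u ++ labelPair s a c ++ v ++ labelPair t b c ++ w)
  have h2 := precede_half_labelPair m ha hc x s (labelPair (!r) a b ++ u)
    (v ++ labelPair t b c ++ w)
  have h3 := precede_half_labelPair m hb hc x t
    (labelPair (!r) a b ++ u ++ labelPair (!s) a c ++ v) w
  simp only [List.nil_append, List.append_assoc, List.count_append, count_labelPair ha hb,
    count_labelPair ha hc, List.count_nil, zero_add, hma, hmb, hmc] at h1 h2 h3 hW ⊢
  rw [hW, h1, h2, h3, Nat.bodd_add, add_assoc, add_assoc]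
  cases x <;> cases (u.count d).bodd <;> cases (v.count d).bodd <;>
    simp [CharTwo.add_self_eq_zero]

/-- Smoothing a crossing of the triangle exchanges the roles of the other two: `b` is mixed before
the move if and only if it is not mixed afterwards, and likewise `c`. -/
theorem crossingTerm_triangle_self {u v w : List ℕ} {a b c : ℕ} (r s t : Bool)
    (hab : a ≠ b) (hac : a ≠ c) (hbc : b ≠ c)
    (hu : a ∉ u ∧ b ∉ u ∧ c ∉ u) (hv : a ∉ v ∧ b ∉ v ∧ c ∉ v) (hw : a ∉ w ∧ b ∉ w ∧ c ∉ w)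
    (h : IsDoubleOccurrence (u ++ (v ++ w))) :
    crossingTerm (labelPair r a b ++ u ++ labelPair s a c ++ v ++ labelPair t b c ++ w) a =
      crossingTerm (labelPair (!r) a b ++ u ++ labelPair (!s) a c ++ v ++
        labelPair (!t) b c ++ w) a := by
  have su := sum_self_eq_zero h
  have svw := sum_self_eq_zero h.swap
  have smu := sum_mixed_eq h
  rw [mixed_comm] at svw
  rw [List.map_append, List.sum_append] at svw smu
  set M := mixed u (v ++ w) with hM
  have nu := List.count_eq_zero_of_not_mem hu.1
  have nv := List.count_eq_zero_of_not_mem hv.1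
  have e1 : ∀ r s t, half a true
      (labelPair r a b ++ u ++ labelPair s a c ++ v ++ labelPair t b c ++ w) =
      (if r then [b] else []) ++ (if s then [] else [c]) ++ v ++ labelPair t b c ++ w := by
    intro r s t
    cases r <;> cases s <;> cases t <;> simp [half_append, half_of_notMem, half, labelPair,
      hu.1, hv.1, hw.1, hab.symm, hac.symm, nu, nv]
  have e2 : ∀ r s t, half a false
      (labelPair r a b ++ u ++ labelPair s a c ++ v ++ labelPair t b c ++ w) =
      (if r then [] else [b]) ++ u ++ (if s then [c] else []) := by
    intro r s t
    cases r <;> cases s <;> cases t <;> simp [half_append, half_of_notMem, half, labelPair,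
      hu.1, hv.1, hw.1, hab.symm, hac.symm, nu, nv]
  -- Letters other than `a`, `b`, `c` are mixed before the move if and only if they are after it.
  have key : ∀ r s t, ∃ m, m = mixed
      (half a true (labelPair r a b ++ u ++ labelPair s a c ++ v ++ labelPair t b c ++ w))
      (half a false (labelPair r a b ++ u ++ labelPair s a c ++ v ++ labelPair t b c ++ w)) ∧
      m b = (if r then 0 else 1) ∧ m c = (if s then 1 else 0) ∧
      ∀ l, l = u ∨ l = v ∨ l = w → precede m l = precede M l ∧ l.map m = l.map M ∧
        (l.map fun x => 1 + m x) = l.map fun x => 1 + M x := by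
    intro r s t
    refine ⟨_, rfl, ?_, ?_, fun l hl => ?_⟩
    · rw [e1, e2]
      cases r <;> cases s <;> cases t <;> simp [mixed, labelPair, hu, hbc]
    · rw [e1, e2]
      cases r <;> cases s <;> cases t <;> simp [mixed, labelPair, hu, hbc.symm]
    · have hm : ∀ x ∈ l, mixed
          (half a true (labelPair r a b ++ u ++ labelPair s a c ++ v ++ labelPair t b c ++ w))
          (half a false (labelPair r a b ++ u ++ labelPair s a c ++ v ++ labelPair t b c ++ w)) x =
          M x := by
        intro x hx
        have hb : x ≠ b := by rintro rfl; rcases hl with rfl | rfl | rfl <;> tauto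
        have hc : x ≠ c := by rintro rfl; rcases hl with rfl | rfl | rfl <;> tauto
        rw [e1, e2]
        cases r <;> cases s <;> cases t <;> simp [mixed, labelPair, hM, hb, hc, and_comm]
      exact ⟨precede_congr hm, List.map_congr_left hm,
        List.map_congr_left fun x hx => by rw [hm x hx]⟩
  obtain ⟨m, hm, mb, mc, hl⟩ := key r s t
  obtain ⟨m', hm', mb', mc', hl'⟩ := key (!r) (!s) (!t)
  obtain ⟨pu, mu, cu⟩ := hl u (by simp)
  obtain ⟨pv, mv, cv⟩ := hl v (by simp)
  obtain ⟨pw, mw, cw⟩ := hl w (by simp)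
  obtain ⟨pu', mu', cu'⟩ := hl' u (by simp)
  obtain ⟨pv', mv', cv'⟩ := hl' v (by simp)
  obtain ⟨pw', mw', cw'⟩ := hl' w (by simp)
  rw [crossingTerm, crossingTerm, splitTerm, splitTerm, ← hm, ← hm', e1, e1, e2, e2]
  clear hm hm' key hl hl' e1 e2 hM
  clear_value M
  rw [CharTwo.add_eq_zero] at svw
  have two : (1 + 1 : ZMod 2) = 0 := by decide
  cases r <;> cases s <;> cases t <;>
  · simp only [Bool.not_true, Bool.not_false, if_true, if_false,
      Bool.false_eq_true] at mb mc mb' mc'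
    simp only [labelPair, *, precede_append, precede, if_true, if_false, Bool.not_true,
      Bool.not_false, List.map_append, List.map_cons, List.sum_append, List.sum_cons,
      List.map_nil, List.sum_nil, List.append_nil, List.nil_append, Bool.false_eq_true]
    generalize ((List.map M v).sum : ZMod 2) = x
    generalize ((List.map M w).sum : ZMod 2) = y
    generalize ((List.map _ w).sum : ZMod 2) = z
    generalize precede _ u = p
    generalize precede _ v = q
    generalize precede _ w = k
    clear * -
    revert x y z p q k
    decide

theorem smoothingInvariant_triangle {u v w : List ℕ} {a b c : ℕ} (r s t : Bool)
    (h : IsDoubleOccurrence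
      (labelPair r a b ++ u ++ labelPair s a c ++ v ++ labelPair t b c ++ w)) :
    smoothingInvariant (labelPair r a b ++ u ++ labelPair s a c ++ v ++ labelPair t b c ++ w) =
      smoothingInvariant (labelPair (!r) a b ++ u ++ labelPair (!s) a c ++ v ++
        labelPair (!t) b c ++ w) := by
  have hm : ∀ r x y z, x ∈ labelPair r y z ↔ x = y ∨ x = z := by
    intro r x y z; cases r <;> simp [labelPair, or_comm]
  have pc : ∀ r x y z, (labelPair r x y).count z = ([x, y] : List ℕ).count z := by
    intro r x y z; cases r
    · rfl
    · exact (List.Perm.swap _ _ _).count_eq _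
  have ha := h a (by simp [hm])
  have hb := h b (by simp [hm])
  have hc := h c (by simp [hm])
  simp only [List.count_append, pc] at ha hb hc
  have hab : a ≠ b := by
    rintro rfl; simp [List.count_cons] at ha; split_ifs at ha <;> omega
  have hac : a ≠ c := by
    rintro rfl; simp [List.count_cons] at ha; split_ifs at ha <;> omega
  have hbc : b ≠ c := by
    rintro rfl; simp [List.count_cons] at hb; split_ifs at hb <;> omega
  obtain ⟨hu, hv, hw⟩ : (a ∉ u ∧ b ∉ u ∧ c ∉ u) ∧ (a ∉ v ∧ b ∉ v ∧ c ∉ v) ∧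
      (a ∉ w ∧ b ∉ w ∧ c ∉ w) := by
    simp only [← List.count_eq_zero]
    simp [hab, hac, hbc, hab.symm, hac.symm, hbc.symm] at ha hb hc
    omega
  have huvw : IsDoubleOccurrence (u ++ (v ++ w)) := by
    intro x hx
    have h1 : x ≠ a := by rintro rfl; simp [hu, hv, hw] at hx
    have h2 : x ≠ b := by rintro rfl; simp [hu, hv, hw] at hx
    have h3 : x ≠ c := by rintro rfl; simp [hu, hv, hw] at hx
    have := h x (by simp only [List.mem_append] at hx ⊢; tauto)
    simp only [List.count_append, pc] at this
    simp [h1.symm, h2.symm, h3.symm] at this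
    simp only [List.count_append]
    omega
  have e : (labelPair r a b ++ u ++ labelPair s a c ++ v ++ labelPair t b c ++ w).toFinset =
      (labelPair (!r) a b ++ u ++ labelPair (!s) a c ++ v ++ labelPair (!t) b c ++ w).toFinset := by
    ext x; simp [hm]
  have h' : IsDoubleOccurrence (labelPair (!r) a b ++ u ++ labelPair (!s) a c ++ v ++
      labelPair (!t) b c ++ w) := by
    refine h.of_perm (List.perm_iff_count.2 fun x => ?_)
    simp only [List.count_append, pc]
  rw [smoothingInvariant, smoothingInvariant, ← e]
  refine Finset.sum_congr rfl fun d hd => ?_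
  -- Cyclic rotation permutes the roles of the three crossings of the triangle.
  have rot1 : ∀ r s t, labelPair r a b ++ u ++ (labelPair s a c ++ v ++ labelPair t b c ++ w) =
      labelPair r a b ++ u ++ labelPair s a c ++ v ++ labelPair t b c ++ w := by simp
  have rot2 : ∀ r s t, labelPair r a b ++ u ++ labelPair s a c ++ v ++ (labelPair t b c ++ w) =
      labelPair r a b ++ u ++ labelPair s a c ++ v ++ labelPair t b c ++ w := by simp
  rw [List.mem_toFinset] at hd
  have hd' := hd
  rw [← List.mem_toFinset, e, List.mem_toFinset] at hd'
  by_cases h1 : d = a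
  · subst h1
    exact crossingTerm_triangle_self r s t hab hac hbc hu hv hw huvw
  by_cases h3 : d = c
  · subst h3
    rw [← rot1] at hd hd' h h' ⊢
    rw [← rot1, crossingTerm_rotate h _ hd, crossingTerm_rotate h' _ hd']
    simp only [← List.append_assoc]
    rw [labelPair_comm s a, labelPair_comm t b, labelPair_comm (!s) a, labelPair_comm (!t) b]
    exact crossingTerm_triangle_self _ _ _ hac.symm hbc.symm hab (by tauto) (by tauto) (by tauto)
      (huvw.of_perm (by simpa using List.perm_append_comm (l₁ := u) (l₂ := v ++ w)))
  by_cases h2 : d = b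
  · subst h2
    rw [← rot2] at hd hd' h h' ⊢
    rw [← rot2, crossingTerm_rotate h _ hd, crossingTerm_rotate h' _ hd']
    simp only [← List.append_assoc]
    rw [labelPair_comm s a, labelPair_comm r a, labelPair_comm (!s) a, labelPair_comm (!r) a]
    exact crossingTerm_triangle_self _ _ _ hbc hab.symm hac.symm (by tauto) (by tauto) (by tauto)
      (huvw.of_perm (by rw [← List.append_assoc]; exact List.perm_append_comm))
  exact crossingTerm_triangle_of_ne r s t (Ne.symm h1) (Ne.symm h2) (Ne.symm h3) hab hac hbc
    hu hv hw

end GaussWord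

open GaussWord

/-! ### Invariance under the moves of Gauss codes -/

/-- The word of the crossings met along the knot. -/
def labels (w : List GaussLetter) : List ℕ := w.map GaussLetter.label

theorem IsGaussCode.eq_or_eq {w : List GaussLetter} (h : IsGaussCode w) {x y : GaussLetter}
    (hx : x ∈ w) (hy : y ∈ w) (e : y.label = x.label) :
    y = x ∨ y = ⟨x.label, !x.isOver, x.pos⟩ := by
  obtain ⟨a, o, s⟩ := x
  obtain ⟨b, o', s'⟩ := y
  dsimp at e
  subst e
  have h1 := (h.2 _ hx).2
  have h2 := (h.2 _ (h.2 _ hx).1).2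
  dsimp at h1 h2
  cases o <;> cases o' <;> cases s <;> cases s' <;> simp_all

theorem IsGaussCode.isDoubleOccurrence {w : List GaussLetter} (h : IsGaussCode w) :
    IsDoubleOccurrence (labels w) := by
  intro a ha
  obtain ⟨x, hx, rfl⟩ := List.mem_map.1 ha
  have hx' := (h.2 x hx).1
  have e : (w.filter fun y => y.label == x.label).toFinset =
      {x, ⟨x.label, !x.isOver, x.pos⟩} := by
    ext y
    simp only [List.mem_toFinset, List.mem_filter, beq_iff_eq, Finset.mem_insert,
      Finset.mem_singleton]
    constructor
    · rintro ⟨hy, hl⟩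
      exact h.eq_or_eq hx hy hl
    · rintro (rfl | rfl)
      · exact ⟨hx, rfl⟩
      · exact ⟨hx', rfl⟩
  have hn : x ≠ ⟨x.label, !x.isOver, x.pos⟩ := by
    obtain ⟨a, o, s⟩ := x; cases o <;> simp
  have hc := congrArg Finset.card e
  rw [Finset.card_pair hn, List.toFinset_card_of_nodup (h.1.filter _)] at hc
  rw [labels, List.count, List.countP_map, List.countP_eq_length_filter]
  exact hc

theorem labels_orderedPair (s : Bool) (x y : GaussLetter) :
    labels (orderedPair s x y) = labelPair s x.label y.label := by
  cases s <;> rfl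

theorem labels_append (u v : List GaussLetter) : labels (u ++ v) = labels u ++ labels v :=
  List.map_append

theorem ReidemeisterMove.smoothingInvariant_eq {w w' : List GaussLetter}
    (h : ReidemeisterMove w w') (hw : IsGaussCode w) (hw' : IsGaussCode w') :
    smoothingInvariant (labels w) = smoothingInvariant (labels w') := by
  have dw := hw.isDoubleOccurrence
  have dw' := hw'.isDoubleOccurrence
  cases h with
  | rotate u v =>
    rw [labels_append] at *
    rw [labels_append, smoothingInvariant_rotate dw]
  | rename f hf w =>
    rw [← smoothingInvariant_map hf]
    simp only [labels, List.map_map]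
    rfl
  | one u a o s =>
    rw [labels_append] at *
    exact (smoothingInvariant_kink dw').symm
  | two_parallel u v a b o s =>
    simp only [labels_append] at *
    have := smoothingInvariant_bigon (u := labels u) (v := labels v) (a := a) (b := b) (.inl rfl)
      (by simpa [labels] using dw')
    simpa [labels] using this.symm
  | two_antiparallel u v a b o s =>
    simp only [labels_append] at *
    have := smoothingInvariant_bigon (u := labels u) (v := labels v) (a := a) (b := b) (.inr rfl)
      (by simpa [labels] using dw')
    simpa [labels] using this.symm
  | three_tmb u v w a b c ea eb ec =>
    simp only [labels_append, labels_orderedPair, bne] at *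
    exact smoothingInvariant_triangle _ _ _ dw
  | three_tbm u v w a b c ea eb ec =>
    simp only [labels_append, labels_orderedPair, bne] at *
    rw [labelPair_comm (ea == eb) a] at dw ⊢
    rw [labelPair_comm (!(ea == eb)) a]
    exact smoothingInvariant_triangle _ _ _ dw

/-- A `Z`-move is invisible to the word of labels. -/
theorem labels_zWord (a : ℕ) (w : List GaussLetter) : labels (zWord a w) = labels w := by
  rw [labels, zWord, List.map_map]
  refine List.map_congr_left fun x _ => ?_
  simp only [Function.comp]
  split <;> rfl

theorem ZMoveEquivalent.smoothingInvariant_eq {K K' : VirtualKnotDiagram}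
    (h : ZMoveEquivalent K K') :
    smoothingInvariant (labels K.word) = smoothingInvariant (labels K'.word) := by
  induction h with
  | rel K K' h =>
    rcases h with h | ⟨a, h⟩
    · exact h.smoothingInvariant_eq K.valid K'.valid
    · rw [h, labels_zWord]
  | refl K => rfl
  | symm K K' _ h => exact h.symm
  | trans K L M _ _ h h' => exact h.trans h'

theorem smoothingInvariant_knotKS : smoothingInvariant (labels knotKS.word) = 1 := by
  decide +kernel

/-! ### Classical knots -/

section Positions

variable {w : List GaussLetter} (h : IsGaussCode w)
include h

theorem IsGaussCode.position_eq {k : ℕ} (hk : k < w.length) :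
    position w w[k].label w[k].isOver = k := by
  rw [position, List.findIdx_eq hk]
  refine ⟨by simp, fun j hj => ?_⟩
  rw [Bool.eq_false_iff]
  intro hp
  simp only [Bool.and_eq_true, beq_iff_eq] at hp
  have hj' : j < w.length := hj.trans hk
  rcases h.eq_or_eq (List.getElem_mem hk) (List.getElem_mem hj') hp.1 with e | e
  · exact hj.ne ((h.1.getElem_inj_iff).1 e)
  · have := congrArg GaussLetter.isOver e
    rw [hp.2] at this
    simp at this

theorem IsGaussCode.isPositive_eq {x : GaussLetter} (hx : x ∈ w) :
    isPositive w x.label = x.pos := by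
  obtain ⟨a, o, s⟩ := x
  have h1 := h.2 _ hx
  have h2 := h.2 _ h1.1
  rw [isPositive, List.contains_eq_mem]
  cases o <;> cases s <;> simp_all

/-- The letter at position `k` runs from slot `i` of its crossing to slot `i + 2`, where `i` is `0`
or `1`. -/
theorem IsGaussCode.slotArc_eq {k : ℕ} (hk : k < w.length) :
    ∃ i : Fin 4, (i = 0 ∨ i = 1) ∧ (slotArc w w[k].label i : ℕ) = k ∧
      (slotArc w w[k].label (i + 2) : ℕ) = k + 1 := by
  have hp := h.isPositive_eq (List.getElem_mem hk)
  have hq := h.position_eq hk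
  by_cases e : w[k].isOver = w[k].pos
  · refine ⟨0, .inl rfl, ?_, ?_⟩ <;> simp [slotArc, hp, ← e, hq] <;> omega
  · have e' : w[k].isOver = !w[k].pos := Bool.eq_not_iff.2 e
    refine ⟨1, .inr rfl, ?_, ?_⟩ <;> simp [slotArc, hp, ← e', hq] <;> omega

theorem IsGaussCode.exists_partner {k : ℕ} (hk : k < w.length) :
    ∃ k', ∃ hk' : k' < w.length, k' ≠ k ∧ w[k'].label = w[k].label ∧
      ∀ j, ∀ hj : j < w.length, w[j].label = w[k].label → j = k ∨ j = k' := by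
  obtain ⟨k', hk', e⟩ := List.getElem_of_mem (h.2 _ (List.getElem_mem hk)).1
  refine ⟨k', hk', ?_, by rw [e], fun j hj hl => ?_⟩
  · rintro rfl
    have := congrArg GaussLetter.isOver e
    simp at this
  · rcases h.eq_or_eq (List.getElem_mem hk) (List.getElem_mem hj) hl with e' | e'
    · exact .inl ((h.1.getElem_inj_iff).1 e')
    · exact .inr ((h.1.getElem_inj_iff).1 (e'.trans e.symm))

/-- The two passages of a crossing use complementary pairs of slots. -/
theorem IsGaussCode.slotArc_partner {k k' : ℕ} (hk : k < w.length) (hk' : k' < w.length)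
    (hne : k' ≠ k) (hl : w[k'].label = w[k].label) :
    ((slotArc w w[k].label 0 : ℕ) = k ∧ (slotArc w w[k].label 1 : ℕ) = k' ∧
      (slotArc w w[k].label 2 : ℕ) = k + 1 ∧ (slotArc w w[k].label 3 : ℕ) = k' + 1) ∨
    ((slotArc w w[k].label 0 : ℕ) = k' ∧ (slotArc w w[k].label 1 : ℕ) = k ∧
      (slotArc w w[k].label 2 : ℕ) = k' + 1 ∧ (slotArc w w[k].label 3 : ℕ) = k + 1) := by
  obtain ⟨i, hi, h1, h2⟩ := h.slotArc_eq hk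
  obtain ⟨j, hj, h3, h4⟩ := h.slotArc_eq hk'
  rw [hl] at h3 h4
  rcases hi with rfl | rfl <;> rcases hj with rfl | rfl
  · omega
  · exact .inl ⟨h1, h3, h2, h4⟩
  · exact .inr ⟨h3, h1, h4, h2⟩
  · omega

end Positions

/-- The difference, modulo `2`, between the values on the two sides of an arc. -/
def sideDifference {N : ℕ} (g : Fin N × Bool → ZMod 2) (k : Fin N) : ZMod 2 :=
  g (k, true) + g (k, false)

/-- A function that is constant on faces satisfies the relations at the four corners. -/
theorem corner_eqs {w : List GaussLetter} {g : Fin (w.length + 1) × Bool → ZMod 2}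
    (hg : ∀ x y, sideJoined w x y → g x = g y) {a : ℕ} (ha : a ∈ crossings w) :
    g (slotArc w a 0, false) = g (slotArc w a 1, true) ∧
    g (slotArc w a 1, false) = g (slotArc w a 2, false) ∧
    g (slotArc w a 2, true) = g (slotArc w a 3, false) ∧
    g (slotArc w a 3, true) = g (slotArc w a 0, true) :=
  ⟨hg _ _ (.inr ⟨a, ha, .inl ⟨rfl, rfl⟩⟩), hg _ _ (.inr ⟨a, ha, .inr (.inl ⟨rfl, rfl⟩)⟩),
    hg _ _ (.inr ⟨a, ha, .inr (.inr (.inl ⟨rfl, rfl⟩))⟩),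
    hg _ _ (.inr ⟨a, ha, .inr (.inr (.inr ⟨rfl, rfl⟩))⟩)⟩

theorem label_mem_crossings {w : List GaussLetter} {k : ℕ} (hk : k < w.length) :
    w[k].label ∈ crossings w := by
  rw [crossings, List.mem_toFinset]
  exact List.mem_map_of_mem (List.getElem_mem hk)

/-- The sum over the two sides changes by the same amount along both strands of a crossing. -/
theorem sideDifference_step {w : List GaussLetter} (h : IsGaussCode w)
    {g : Fin (w.length + 1) × Bool → ZMod 2}
    (hg : ∀ x y, sideJoined w x y → g x = g y) {k : ℕ} (hk : k < w.length) :
    sideDifference g ⟨k + 1, by omega⟩ + sideDifference g ⟨k, by omega⟩ =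
      sideDifference g (slotArc w w[k].label 2) + sideDifference g (slotArc w w[k].label 0) := by
  obtain ⟨i, hi, h1, h2⟩ := h.slotArc_eq hk
  have e1 : slotArc w w[k].label i = ⟨k, by omega⟩ := Fin.ext h1
  have e2 : slotArc w w[k].label (i + 2) = ⟨k + 1, by omega⟩ := Fin.ext h2
  obtain ⟨c1, c2, c3, c4⟩ := corner_eqs hg (label_mem_crossings hk)
  rw [← e1, ← e2]
  rcases hi with rfl | rfl
  · rfl
  · have : (1 + 2 : Fin 4) = 3 := rfl
    rw [this, sideDifference, sideDifference, sideDifference, sideDifference, ← c3, c4, c1, c2]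
    ring

open Classical in
/-- On a sphere, every cycle is a boundary: there is a function on the faces whose differences
across arcs start with `c` and change at the crossing `a` by `s a`. The homogeneous conditions are
satisfied by constant functions only, and there are `n + 2` faces, against `n + 1` conditions. -/
theorem VirtualKnotDiagram.IsClassical.exists_faceFunction {K : VirtualKnotDiagram}
    (hK : K.IsClassical) (c : ZMod 2) (s : ℕ → ZMod 2) :
    ∃ g : Fin (K.word.length + 1) × Bool → ZMod 2, (∀ x y, sideJoined K.word x y → g x = g y) ∧
      sideDifference g 0 = c ∧ ∀ a ∈ crossings K.word,
        sideDifference g (slotArc K.word a 2) + sideDifference g (slotArc K.word a 0) = s a := by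
  set w := K.word with hw
  let F := Quot (sideJoined w)
  have : Fintype F := Fintype.ofFinite F
  let pull : (F → ZMod 2) → Fin (w.length + 1) × Bool → ZMod 2 := fun f x => f (Quot.mk _ x)
  have hpull : ∀ f x y, sideJoined w x y → pull f x = pull f y := fun f x y hxy =>
    congrArg f (Quot.sound hxy)
  let Φ : (F → ZMod 2) →ₗ[ZMod 2] ZMod 2 × (crossings w → ZMod 2) :=
    { toFun := fun f => (sideDifference (pull f) 0, fun a =>
        sideDifference (pull f) (slotArc w a 2) + sideDifference (pull f) (slotArc w a 0))
      map_add' := fun f f' => by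
        ext <;> simp [pull, sideDifference] <;> ring
      map_smul' := fun r f => by
        ext <;> simp [pull, sideDifference] <;> ring }
  have hker : LinearMap.ker Φ ≤ Submodule.span (ZMod 2) {fun _ => 1} := by
    intro f hf
    have hf' : Φ f = 0 := hf
    have f1 : sideDifference (pull f) 0 = 0 := congrArg Prod.fst hf'
    have f2 : ∀ a ∈ crossings w, sideDifference (pull f) (slotArc w a 2) +
        sideDifference (pull f) (slotArc w a 0) = 0 := fun a ha =>
      congrFun (congrArg Prod.snd hf') ⟨a, ha⟩
    have diff : ∀ k, ∀ hk : k < w.length + 1, sideDifference (pull f) ⟨k, hk⟩ = 0 := by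
      intro k
      induction k with
      | zero => exact fun _ => f1
      | succ k ih =>
        intro hk
        have := sideDifference_step K.valid (hpull f) (Nat.lt_of_succ_lt_succ hk)
        rw [ih (by omega), f2 _ (label_mem_crossings _), add_zero] at this
        exact this
    have sides : ∀ k b, pull f (k, b) = pull f (k, true) := by
      intro k b
      cases b
      · exact (CharTwo.add_eq_zero.1 (diff k.1 k.2)).symm
      · rfl
    have const : ∀ k, ∀ hk : k < w.length + 1, pull f (⟨k, hk⟩, true) = pull f (0, true) := by
      intro k
      induction k with
      | zero => exact fun _ => rfl
      | succ k ih =>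
        intro hk
        rw [← ih (by omega)]
        have hk' : k < w.length := by omega
        obtain ⟨i, hi, h1, h2⟩ := K.valid.slotArc_eq hk'
        have e1 : slotArc w w[k].label i = ⟨k, by omega⟩ := Fin.ext h1
        have e2 : slotArc w w[k].label (i + 2) = ⟨k + 1, by omega⟩ := Fin.ext h2
        obtain ⟨c1, c2, c3, c4⟩ := corner_eqs (hpull f) (label_mem_crossings hk')
        rw [← e1, ← e2]
        rw [sides _ false] at c1 c2 c3
        rw [sides _ false] at c2
        rcases hi with rfl | rfl
        · exact c3.trans c4
        · exact (c4.trans c1)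
    rw [Submodule.mem_span_singleton]
    refine ⟨pull f (0, true), funext fun x => ?_⟩
    obtain ⟨⟨k, b⟩, rfl⟩ := Quot.exists_rep x
    simp only [Pi.smul_apply, smul_eq_mul, mul_one]
    exact ((sides k b).trans (const k.1 k.2)).symm
  have hsurj : LinearMap.range Φ = ⊤ := by
    refine Submodule.eq_top_of_finrank_eq (le_antisymm (Submodule.finrank_le _) ?_)
    have h1 := LinearMap.finrank_range_add_finrank_ker Φ
    have h2 : Module.finrank (ZMod 2) (LinearMap.ker Φ) ≤ 1 :=
      (Submodule.finrank_mono hker).trans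
        ((finrank_span_le_card _).trans (by simp))
    have h3 : Module.finrank (ZMod 2) (F → ZMod 2) = (crossings w).card + 2 := by
      rw [Module.finrank_pi, ← Nat.card_eq_fintype_card]
      exact hK
    have h4 : Module.finrank (ZMod 2) (ZMod 2 × (crossings w → ZMod 2)) =
        1 + (crossings w).card := by
      simp
    omega
  obtain ⟨f, hf⟩ := LinearMap.range_eq_top.1 hsurj (c, fun a => s a)
  exact ⟨pull f, hpull f, congrArg Prod.fst hf, fun a ha =>
    congrFun (congrArg Prod.snd hf) ⟨a, ha⟩⟩

namespace GaussWord

/-- Letter by letter, `precede` integrates a function that changes at mixed letters only. -/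
theorem precede_add_mul_sum {M f : ℕ → ZMod 2} {y : List ℕ} {L : ℕ → ZMod 2}
    (hM : ∀ x, M x = 0 ∨ M x = 1)
    (h : ∀ j (hj : j < y.length), L (j + 1) = L j + M y[j] ∧ (M y[j] = 0 → L j = f y[j])) :
    precede M y + L 0 * (y.map fun x => 1 + M x).sum = (y.map fun x => (1 + M x) * f x).sum := by
  induction y generalizing L with
  | nil => simp [precede]
  | cons x y ih =>
    have h0 := h 0 (by simp)
    simp only [List.getElem_cons_zero, zero_add] at h0
    have := ih (L := fun j => L (j + 1)) fun j hj => h (j + 1) (by simpa using hj)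
    simp only [precede, List.map_cons, List.sum_cons, ← this, zero_add, h0.1]
    rcases hM x with e | e
    · rw [e, h0.2 e]; ring
    · rw [e, CharTwo.add_self_eq_zero]; ring

theorem exists_eq_append_of_count {w : List ℕ} {d : ℕ} (h : w.count d = 2) :
    ∃ x y z, w = x ++ d :: y ++ d :: z ∧ d ∉ x ∧ d ∉ y ∧ d ∉ z := by
  have h1 : d ∈ w := List.count_pos_iff.1 (by omega)
  obtain ⟨x, t, rfl, hx⟩ := List.eq_append_cons_of_mem h1
  rw [List.count_append, List.count_cons_self, List.count_eq_zero_of_not_mem hx] at h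
  have h2 : d ∈ t := List.count_pos_iff.1 (by omega)
  obtain ⟨y, z, rfl, hy⟩ := List.eq_append_cons_of_mem h2
  rw [List.count_append, List.count_cons_self, List.count_eq_zero_of_not_mem hy] at h
  exact ⟨x, y, z, by simp, hx, hy, List.count_eq_zero.1 (by omega)⟩

end GaussWord

/-- Let the outer half of the knot be the boundary of a set of faces. Along the inner half,
membership of the face on the left changes exactly at the mixed crossings, and it has the same
value at both passages of a self-crossing. Hence every loop of the inner half meets the outer half
an even number of times. -/
theorem VirtualKnotDiagram.IsClassical.crossingTerm_eq_zero {K : VirtualKnotDiagram}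
    (hK : K.IsClassical) {d : ℕ} (hd : d ∈ labels K.word) : crossingTerm (labels K.word) d = 0 := by
  have dbl := K.valid.isDoubleOccurrence
  obtain ⟨x, y, z, e, hx, hy, hz⟩ := exists_eq_append_of_count (dbl d hd)
  have nx := List.count_eq_zero_of_not_mem hx
  have ny := List.count_eq_zero_of_not_mem hy
  have et : half d true (labels K.word) = x ++ z := by
    rw [e]; simp [half_append, half_of_notMem, half, hx, hy, hz, nx, ny]
  have ef : half d false (labels K.word) = y := by
    rw [e]; simp [half_append, half_of_notMem, half, hx, hy, hz, nx, ny]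
  have dbl' := dbl.half d true
  rw [et, Bool.not_true, ef] at dbl'
  rw [crossingTerm, splitTerm, et, ef]
  set M := mixed (x ++ z) y with hM
  suffices precede M y = 0 by rw [this, mul_zero]
  have selfy := sum_self_eq_zero dbl'.swap
  rw [mixed_comm] at selfy
  -- The outer half is the cycle that contains the arc `0` and changes at `d` only.
  obtain ⟨g, hg, g0, gs⟩ := hK.exists_faceFunction 1 fun a => if a = d then 1 else 0
  have len : K.word.length = x.length + y.length + z.length + 2 := by
    have := congrArg List.length e
    simp [labels] at this
    omega
  have lab : ∀ k (hk : k < K.word.length), K.word[k].label =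
      (x ++ d :: y ++ d :: z)[k]'(by rw [← e]; simpa [labels] using hk) := by
    intro k hk
    simp [← e, labels]
  have labx : ∀ i (hi : i < x.length), K.word[i].label = x[i] := by
    intro i hi
    rw [lab]; grind
  have laby : ∀ j (hj : j < y.length), K.word[x.length + 1 + j].label = y[j] := by
    intro j hj
    rw [lab]; grind
  have labz : ∀ j (hj : j < z.length),
      K.word[x.length + 1 + y.length + 1 + j].label = z[j] := by
    intro j hj
    rw [lab]; grind
  have labd : ∀ k (hk : k < K.word.length), K.word[k].label = d ↔
      k = x.length ∨ k = x.length + 1 + y.length := by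
    intro k hk
    rw [lab]; grind
  have diff : ∀ k (hk : k < K.word.length + 1), sideDifference g ⟨k, hk⟩ =
      if x.length < k ∧ k ≤ x.length + 1 + y.length then 0 else 1 := by
    intro k
    induction k with
    | zero => exact fun _ => by rw [if_neg (by omega)]; exact g0
    | succ k ih =>
      intro hk
      have hk' : k < K.word.length := by omega
      have := sideDifference_step K.valid hg hk'
      rw [ih (by omega), gs _ (label_mem_crossings _), CharTwo.add_eq_iff_eq_add] at this
      rw [this]
      have := labd k hk'
      by_cases h : K.word[k].label = d
      · rw [if_pos h]
        rcases this.1 h with rfl | rfl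
        · rw [if_neg (by omega), if_pos (by omega)]; exact CharTwo.add_self_eq_zero 1
        · rw [if_pos (by omega), if_neg (by omega), add_zero]
      · rw [if_neg h, zero_add]
        have hk1 : k ≠ x.length ∧ k ≠ x.length + 1 + y.length := by tauto
        exact if_congr (by omega) rfl rfl
  -- `L j` is the value on the left of the arc that enters the `j`-th letter of the inner half.
  have key := precede_add_mul_sum (M := M) (y := y)
    (f := fun a => g (slotArc K.word a 0, true))
    (L := fun j => if hj : x.length + 1 + j < K.word.length + 1
      then g (⟨x.length + 1 + j, hj⟩, true) else 0)
    (fun a => by rw [hM, mixed]; split <;> simp) ?_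
  · rw [selfy, mul_zero, add_zero] at key
    rw [key]
    refine sum_map_eq_zero fun a ha => ?_
    by_cases hm : a ∈ x ++ z
    · left; rw [hM, mixed, if_pos ⟨hm, ha⟩, CharTwo.add_self_eq_zero, zero_mul]
    · right
      have := dbl' a (by simp [ha])
      rw [List.count_append, List.count_eq_zero_of_not_mem hm, zero_add] at this
      rw [this]; exact even_two
  intro j hj
  have hk : x.length + 1 + j < K.word.length := by omega
  have hl := laby j hj
  have hd : y[j] ≠ d := fun h => hy (h ▸ List.getElem_mem hj)
  obtain ⟨k', hk', hne, hl', huniq⟩ := K.valid.exists_partner hk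
  have hc := corner_eqs hg (label_mem_crossings hk)
  have hp := K.valid.slotArc_partner hk hk' hne hl'
  -- The other passage of the crossing is outside if and only if the crossing is mixed.
  have hM' : M y[j] = sideDifference g ⟨k', by omega⟩ ∧
      M y[j] = sideDifference g ⟨k' + 1, by omega⟩ := by
    have hkd : k' ≠ x.length ∧ k' ≠ x.length + 1 + y.length := by
      have := (labd k' hk').not.1 (by rw [hl', hl]; exact hd)
      tauto
    rw [diff, diff]
    by_cases hm : y[j] ∈ x ++ z
    · have hout : ¬ (x.length < k' ∧ k' < x.length + 1 + y.length) := by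
        rcases List.mem_append.1 hm with hm | hm
        · obtain ⟨i, hi, ei⟩ := List.getElem_of_mem hm
          have := huniq i (by omega) (by rw [labx i hi, hl, ei])
          omega
        · obtain ⟨i, hi, ei⟩ := List.getElem_of_mem hm
          have := huniq _ (by omega) ((labz i hi).trans (ei.trans hl.symm))
          omega
      rw [hM, mixed, if_pos ⟨hm, List.getElem_mem hj⟩, if_neg (by omega), if_neg (by omega)]
      exact ⟨rfl, rfl⟩
    · have hx' : ¬ k' < x.length := fun hi => hm <| by
        rw [← hl, ← hl', labx k' hi]; simp
      have hz' : ¬ x.length + 1 + y.length < k' := fun hi => hm <| by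
        obtain ⟨i, rfl⟩ := Nat.exists_eq_add_of_lt hi
        have hi' : i < z.length := by omega
        have := labz i hi'
        rw [← hl, ← hl']
        have e' : x.length + 1 + y.length + i + 1 = x.length + 1 + y.length + 1 + i := by omega
        simp only [e', this, List.mem_append, List.getElem_mem, or_true]
      rw [hM, mixed, if_neg (fun h => hm h.1), if_pos (by omega), if_pos (by omega)]
      exact ⟨rfl, rfl⟩
  rw [hl] at hc hp
  rw [dif_pos (by omega), dif_pos (by omega)]
  obtain ⟨c1, c2, c3, c4⟩ := hc
  rcases hp with ⟨h0, h1, h2, h3⟩ | ⟨h0, h1, h2, h3⟩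
  · have e0 : slotArc K.word y[j] 0 = ⟨x.length + 1 + j, by omega⟩ := Fin.ext h0
    have e2 : slotArc K.word y[j] 2 = ⟨x.length + 1 + (j + 1), by omega⟩ := Fin.ext h2
    have e3 : slotArc K.word y[j] 3 = ⟨k' + 1, by omega⟩ := Fin.ext h3
    refine ⟨?_, fun _ => by rw [e0]⟩
    rw [hM'.2, sideDifference, ← e3, ← c3, c4, e0, e2, ← add_assoc (g _) (g _) (g _),
      CharTwo.add_self_eq_zero, zero_add]
  · have e0 : slotArc K.word y[j] 0 = ⟨k', by omega⟩ := Fin.ext h0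
    have e1 : slotArc K.word y[j] 1 = ⟨x.length + 1 + j, by omega⟩ := Fin.ext h1
    have e3 : slotArc K.word y[j] 3 = ⟨x.length + 1 + (j + 1), by omega⟩ := Fin.ext h3
    have hstep : M y[j] = g (slotArc K.word y[j] 3, true) + g (slotArc K.word y[j] 1, true) := by
      rw [hM'.1, sideDifference, ← e0, c1, c4]
    rw [← e1, ← e3]
    refine ⟨?_, fun h => ?_⟩
    · rw [hstep, add_comm (g (slotArc _ _ 3, _)), ← add_assoc (g _) (g _) (g _),
        CharTwo.add_self_eq_zero, zero_add]
    · rw [hstep, CharTwo.add_eq_zero] at h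
      rw [← h, c4]

theorem VirtualKnotDiagram.IsClassical.smoothingInvariant_eq_zero {K : VirtualKnotDiagram}
    (hK : K.IsClassical) : smoothingInvariant (labels K.word) = 0 :=
  Finset.sum_eq_zero fun _ hd => hK.crossingTerm_eq_zero (List.mem_toFinset.1 hd)

/-! ### The Jones polynomial of `KS` -/

/-- Labels `l` of `n` points are merged along the given pairs of points, one pair after another. -/
def mergeLabels {n : ℕ} : List (Fin n × Fin n) → List ℕ → List ℕ
  | [], l => l
  | e :: E, l =>
    mergeLabels E (l.map fun t => if t = l.getD e.1 0 then l.getD e.2 0 else t)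

section MergeLabels

variable {n : ℕ}

theorem length_mergeLabels (E : List (Fin n × Fin n)) (l : List ℕ) :
    (mergeLabels E l).length = l.length := by
  induction E generalizing l with
  | nil => rfl
  | cons e E ih => rw [mergeLabels, ih, List.length_map]

theorem getD_mergeStep {l : List ℕ} (hl : l.length = n) (i x y : Fin n) :
    (l.map fun t => if t = l.getD x 0 then l.getD y 0 else t).getD i 0 =
      if l.getD i 0 = l.getD x 0 then l.getD y 0 else l.getD i 0 := by
  subst hl
  simp

theorem mergeLabels_mono {E : List (Fin n × Fin n)} {l : List ℕ} (hl : l.length = n) {i j : Fin n}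
    (h : l.getD i 0 = l.getD j 0) : (mergeLabels E l).getD i 0 = (mergeLabels E l).getD j 0 := by
  induction E generalizing l with
  | nil => exact h
  | cons e E ih =>
    refine ih (by rwa [List.length_map]) ?_
    rw [getD_mergeStep hl, getD_mergeStep hl, h]

theorem mergeLabels_of_mem {E : List (Fin n × Fin n)} {l : List ℕ} (hl : l.length = n)
    {e : Fin n × Fin n} (h : e ∈ E) :
    (mergeLabels E l).getD e.1 0 = (mergeLabels E l).getD e.2 0 := by
  induction E generalizing l with
  | nil => simp at h
  | cons e' E ih =>
    rcases List.mem_cons.1 h with rfl | h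
    · rw [mergeLabels]
      refine mergeLabels_mono (by rwa [List.length_map]) ?_
      rw [getD_mergeStep hl, getD_mergeStep hl, if_pos rfl, ite_self]
    · exact ih (by rwa [List.length_map]) h

/-- Points with equal final labels are identified in every quotient that identifies the given
pairs. -/
theorem eq_of_mergeLabels_eq {Q : Type*} (mk : Fin n → Q) {E : List (Fin n × Fin n)} {l : List ℕ}
    (hl : l.length = n) (hE : ∀ e ∈ E, mk e.1 = mk e.2)
    (h : ∀ i j : Fin n, l.getD i 0 = l.getD j 0 → mk i = mk j) {i j : Fin n}
    (hij : (mergeLabels E l).getD i 0 = (mergeLabels E l).getD j 0) : mk i = mk j := by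
  induction E generalizing l with
  | nil => exact h i j hij
  | cons e E ih =>
    have he := hE e (by simp)
    refine ih (by rwa [List.length_map]) (fun e' h' => hE e' (by simp [h'])) (fun i j h' => ?_) hij
    rw [getD_mergeStep hl, getD_mergeStep hl] at h'
    split_ifs at h' with h1 h2 h2
    · exact h i j (h1.trans h2.symm)
    · rw [h i _ h1, he, h _ j h']
    · rw [h j _ h2, he, h i _ h']
    · exact h i j h'

theorem natCard_quot {r : Fin n → Fin n → Prop} {E : List (Fin n × Fin n)}
    (h : ∀ i j, r i j ↔ (i, j) ∈ E) :
    Nat.card (Quot r) = (mergeLabels E (List.range n)).dedup.length := by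
  set m := mergeLabels E (List.range n) with hm
  have hl : (List.range n).length = n := List.length_range
  have hlm : m.length = n := (length_mergeLabels _ _).trans hl
  let φ : Quot r → m.toFinset := Quot.lift
    (fun i => ⟨m.getD i 0, by
      rw [List.getD_eq_getElem _ _ (by rw [hlm]; exact i.2), List.mem_toFinset]
      exact List.getElem_mem _⟩)
    (fun i j hij => Subtype.ext (mergeLabels_of_mem hl ((h i j).1 hij)))
  have hφ : Function.Bijective φ := by
    constructor
    · rintro ⟨i⟩ ⟨j⟩ hij
      refine eq_of_mergeLabels_eq (Quot.mk r) hl (fun e he => Quot.sound ((h _ _).2 he))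
        (fun i j hij => ?_) (congrArg Subtype.val hij)
      congr 1
      simpa [Fin.ext_iff] using hij
    · rintro ⟨t, ht⟩
      obtain ⟨i, hi, rfl⟩ := List.getElem_of_mem (List.mem_toFinset.1 ht)
      exact ⟨Quot.mk r ⟨i, hlm ▸ hi⟩, Subtype.ext (List.getD_eq_getElem _ _ hi)⟩
  rw [Nat.card_congr (Equiv.ofBijective φ hφ), Nat.card_eq_fintype_card, Fintype.card_coe]
  rfl

end MergeLabels

/-- The pairs of arcs that are joined in a state, the smoothed crossings being listed in `L`. -/
def joinedPairs (w : List GaussLetter) (L : List ℕ) (T : Finset ℕ) :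
    List (Fin (w.length + 1) × Fin (w.length + 1)) :=
  (0, Fin.last w.length) :: L.flatMap fun a =>
    (smoothingPairs w a (decide (a ∈ T))).map fun p => (slotArc w a p.1, slotArc w a p.2)

theorem joined_iff_mem_joinedPairs {w : List GaussLetter} {L : List ℕ} {S T : Finset ℕ}
    (hL : S = L.toFinset) (x y : Fin (w.length + 1)) :
    joined w S T x y ↔ (x, y) ∈ joinedPairs w L T := by
  subst hL
  simp [joined, joinedPairs, eq_comm]

/-- The number of loops of a state. -/
def loopCount (w : List GaussLetter) (L : List ℕ) (T : Finset ℕ) : ℕ :=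
  (mergeLabels (joinedPairs w L T) (List.range (w.length + 1))).dedup.length

theorem natCard_stateArc {w : List GaussLetter} {L : List ℕ} {S : Finset ℕ}
    (hL : S = L.toFinset) (T : Finset ℕ) : Nat.card (StateArc w S T) = loopCount w L T :=
  natCard_quot (joined_iff_mem_joinedPairs hL)

/-- For each of the 32 states, the number of `A`-smoothings and the number of loops. -/
theorem loopCounts_knotKS :
    (Finset.powerset {0, 2, 3, 4, 6}).val.map
      (fun T : Finset ℕ => (T.card, loopCount knotKS.word [0, 2, 3, 4, 6] T)) =
    {(0, 1), (1, 2), (1, 1), (2, 2), (1, 1), (2, 1), (2, 2), (3, 1), (1, 1), (2, 2), (2, 1), (3, 2),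
      (2, 2), (3, 1), (3, 1), (4, 1), (1, 2), (2, 3), (2, 2), (3, 3), (2, 1), (3, 2), (3, 1),
      (4, 2), (2, 1), (3, 2), (3, 1), (4, 2), (3, 2), (4, 1), (4, 1), (5, 1)} := by
  decide +kernel

theorem T_mul_loopValue (k : ℤ) : (LaurentPolynomial.T k : ℤ[T;T⁻¹]) * loopValue =
    -LaurentPolynomial.T (k + 2) - LaurentPolynomial.T (k - 2) := by
  rw [loopValue, mul_sub, mul_neg, ← LaurentPolynomial.T_add, ← LaurentPolynomial.T_add]
  rfl

theorem kauffmanBracket_knotKS : kauffmanBracket knotKS = -LaurentPolynomial.T (-3) := by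
  have hc : crossings knotKS.word = {0, 2, 3, 4, 6} := by decide +kernel
  have hsum : kauffmanBracket knotKS = (((Finset.powerset {0, 2, 3, 4, 6}).val.map
      (fun T : Finset ℕ => (T.card, loopCount knotKS.word [0, 2, 3, 4, 6] T))).map
      fun p => LaurentPolynomial.T (2 * (p.1 : ℤ) - 5) * loopValue ^ (p.2 - 1)).sum := by
    rw [kauffmanBracket, Multiset.map_map, hc]
    refine Finset.sum_congr rfl fun T _ => ?_
    rw [natCard_stateArc (L := [0, 2, 3, 4, 6]) (by decide)]
    rfl
  rw [hsum, loopCounts_knotKS]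
  simp only [Multiset.insert_eq_cons, Multiset.map_cons, Multiset.sum_cons, Multiset.map_singleton,
    Multiset.sum_singleton, Nat.sub_self, pow_zero, mul_one, Nat.add_one_sub_one, pow_one,
    pow_two, ← mul_assoc, T_mul_loopValue, sub_mul, neg_mul]
  simp only [Nat.cast_ofNat, Nat.cast_zero, Nat.cast_one, Int.reduceMul, Int.reduceSub,
    Int.reduceAdd, Int.reduceNeg, mul_zero, mul_one, zero_sub]
  ring

theorem jonesPolynomial_knotKS : jonesPolynomial knotKS = 1 := by
  have hw : writhe knotKS.word = -1 := by decide +kernel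
  rw [jonesPolynomial, kauffmanBracket_knotKS, hw]
  rw [show (-3 * -1 : ℤ) = 3 from rfl, show (-1 : ℤ).natAbs = 1 from rfl, pow_one, neg_one_mul,
    neg_mul_neg, ← LaurentPolynomial.T_add]
  simp

/-! ### The parity states of `KS` -/

namespace NodeGraph

/-- The graph with nodes `Fin n` and edges `Fin m` that has the given incidences. -/
def ofInc {n m : ℕ} (inc : Fin n → Fin 4 → Fin m) : NodeGraph where
  V := Fin n
  E := Fin m
  finV := inferInstance
  finE := inferInstance
  inc := inc

theorem Iso.isFourValent {G H : NodeGraph} (h : G.Iso H) (hH : H.IsFourValent) :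
    G.IsFourValent := by
  obtain ⟨f, g, r, hfg⟩ := h
  intro e
  have := Nat.card_congr ((Equiv.prodShear f fun v => Equiv.addRight (r v)).subtypeEquiv
    (p := fun p => G.inc p.1 p.2 = e) (q := fun p => H.inc p.1 p.2 = g e) fun p => by
      simp [hfg])
  rw [this]
  exact hH (g e)

theorem isFourValent_ofInc {n m : ℕ} {inc : Fin n → Fin 4 → Fin m}
    (h : ∀ e, (Finset.univ.filter fun p : Fin n × Fin 4 => inc p.1 p.2 = e).card = 2) :
    (ofInc inc).IsFourValent := by
  intro (e : Fin m)
  right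
  change Nat.card {p : Fin n × Fin 4 // inc p.1 p.2 = e} = 2
  rw [Nat.card_eq_fintype_card, Fintype.card_subtype, h]

theorem Iso.freeLoopCount_eq_zero {G : NodeGraph} {n m : ℕ} {inc : Fin n → Fin 4 → Fin m}
    (h : G.Iso (ofInc inc)) (hinc : ∀ e, ∃ v s, inc v s = e) : G.freeLoopCount = 0 := by
  obtain ⟨f, g, r, hfg⟩ := h
  rw [freeLoopCount, Nat.card_eq_zero]
  refine .inl ⟨fun ⟨e, he⟩ => ?_⟩
  obtain ⟨v, s, hv⟩ : ∃ (v : (ofInc inc).V) (s : Fin 4), (ofInc inc).inc v s = g e := hinc (g e)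
  refine he (f.symm v) (s - r (f.symm v)) (g.injective ?_)
  rw [← hfg, f.apply_symm_apply, sub_add_cancel, hv]

theorem Iso.natCard_V {G H : NodeGraph} (h : G.Iso H) : Nat.card G.V = Nat.card H.V :=
  Nat.card_congr h.choose

/-- No bigon arises however the cyclic orders at the nodes are chosen: two different nodes are not
joined by two edges that are adjacent at both nodes. Only the pairs of opposite slots matter here,
and these are preserved by graphical `Z`-moves. -/
def HasNoFramedBigon (G : NodeGraph) : Prop :=
  ∀ u v, u ≠ v → ∀ i i' j j' : Fin 4, i' ≠ i → i' ≠ i + 2 → j' ≠ j → j' ≠ j + 2 →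
    G.inc u i = G.inc v j → G.inc u i' ≠ G.inc v j'

theorem hasNoFramedBigon_ofInc {n m : ℕ} {inc : Fin n → Fin 4 → Fin m}
    (h : ∀ u v, u ≠ v → ∀ i i' j j' : Fin 4, i' ≠ i → i' ≠ i + 2 → j' ≠ j → j' ≠ j + 2 →
      inc u i = inc v j → inc u i' ≠ inc v j') : (ofInc inc).HasNoFramedBigon :=
  h

theorem HasNoFramedBigon.not_bigon {G : NodeGraph} (h : G.HasNoFramedBigon) :
    ¬ ∃ u v, G.Bigon u v := by
  rintro ⟨u, v, huv, i, j, h1, h2⟩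
  have h' : ∀ i : Fin 4, i + 1 ≠ i ∧ i + 1 ≠ i + 2 ∧ i ≠ i + 1 ∧ i ≠ i + 1 + 2 := by decide
  exact h u v huv i (i + 1) (j + 1) j (h' i).1 (h' i).2.1 (h' j).2.2.1 (h' j).2.2.2 h1 h2

/-- The property only depends on which slots are opposite. -/
theorem HasNoFramedBigon.of_slots {G H : NodeGraph} (hG : G.HasNoFramedBigon) (f : H.V → G.V)
    (hf : Function.Injective f) (g : H.E → G.E) (σ : H.V → Fin 4 → Fin 4)
    (hσ : ∀ v i i', i' ≠ i → i' ≠ i + 2 → σ v i' ≠ σ v i ∧ σ v i' ≠ σ v i + 2)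
    (h : ∀ v s, G.inc (f v) (σ v s) = g (H.inc v s)) : H.HasNoFramedBigon := by
  intro u v huv i i' j j' hi hi' hj hj' h1 h2
  refine hG (f u) (f v) (hf.ne huv) (σ u i) (σ u i') (σ v j) (σ v j') (hσ u i i' hi hi').1
    (hσ u i i' hi hi').2 (hσ v j j' hj hj').1 (hσ v j j' hj hj').2 ?_ ?_
  · rw [h, h, h1]
  · rw [h, h, h2]

theorem Iso.symm {G H : NodeGraph} (h : G.Iso H) : H.Iso G := by
  obtain ⟨f, g, r, hfg⟩ := h
  refine ⟨f.symm, g.symm, fun v => -r (f.symm v), fun v s => ?_⟩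
  rw [← g.apply_eq_iff_eq, ← hfg, f.apply_symm_apply, g.apply_symm_apply, neg_add_cancel_right]

theorem Iso.hasNoFramedBigon {G H : NodeGraph} (h : G.Iso H) (hG : H.HasNoFramedBigon) :
    G.HasNoFramedBigon := by
  obtain ⟨f, g, r, hfg⟩ := h
  refine hG.of_slots f f.injective g (fun v s => s + r v) (fun v i i' h1 h2 => ?_) hfg
  refine ⟨fun e => h1 (add_right_cancel e), fun e => h2 (add_right_cancel (b := r v) ?_)⟩
  rw [e, add_right_comm]

theorem HasNoFramedBigon.zFlip {G : NodeGraph} (hG : G.HasNoFramedBigon) (v : G.V) :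
    (G.zFlip v).HasNoFramedBigon := by
  classical
  refine hG.of_slots id Function.injective_id id (fun x s => if x = v then -s else s) ?_ ?_
  · have h : ∀ i i' : Fin 4, i' ≠ i → i' ≠ i + 2 → -i' ≠ -i ∧ -i' ≠ -i + 2 := by decide
    intro x i i' h1 h2
    by_cases hx : x = v
    · simpa only [if_pos hx] using h i i' h1 h2
    · simpa only [if_neg hx] using ⟨h1, h2⟩
  · intro x s
    change G.inc x (if x = v then -s else s) = if x = v then G.inc x (-s) else G.inc x s
    split_ifs <;> rfl

theorem HasNoFramedBigon.isIrreducible {G : NodeGraph} (hG : G.HasNoFramedBigon)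
    (h4 : G.IsFourValent) (hV : Nonempty G.V) : G.IsIrreducible := by
  refine ⟨h4, hV, fun H hH => HasNoFramedBigon.not_bigon ?_⟩
  induction hH with
  | refl => exact hG
  | tail _ h ih =>
    rcases h with h | ⟨v, rfl⟩
    · exact h.symm.hasNoFramedBigon ih
    · exact ih.zFlip v

/-- A description by a finite table of a graph whose edges are classes of arcs. -/
theorem iso_ofInc {V : Type} {k n m : ℕ} {r : Fin k → Fin k → Prop} {finV : Finite V}
    {finE : Finite (Quot r)} {slot : V → Fin 4 → Fin k} {E : List (Fin k × Fin k)}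
    (hr : ∀ i j, r i j ↔ (i, j) ∈ E) (ν : Fin n → V) (hν : Function.Bijective ν)
    (c : Fin k → Fin m) (hc : Function.Surjective c) (hE : ∀ e ∈ E, c e.1 = c e.2)
    (hinj : ∀ i j, c i = c j → (mergeLabels E (List.range k)).getD i 0 =
      (mergeLabels E (List.range k)).getD j 0)
    {inc : Fin n → Fin 4 → Fin m} (hinc : ∀ i s, inc i s = c (slot (ν i) s)) :
    (NodeGraph.mk V (Quot r) finV finE fun v s => Quot.mk r (slot v s)).Iso (ofInc inc) := by
  let φ : Quot r → Fin m := Quot.lift c fun i j h => hE _ ((hr i j).1 h)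
  have hφ : Function.Bijective φ := by
    constructor
    · rintro ⟨i⟩ ⟨j⟩ hij
      refine eq_of_mergeLabels_eq (Quot.mk r) List.length_range
        (fun e he => Quot.sound ((hr _ _).2 he)) (fun i j hij => ?_) (hinj i j hij)
      congr 1
      simpa [Fin.ext_iff] using hij
    · intro t
      obtain ⟨i, rfl⟩ := hc t
      exact ⟨Quot.mk r i, rfl⟩
  refine ⟨(Equiv.ofBijective ν hν).symm, Equiv.ofBijective φ hφ, fun _ => 0, fun v s => ?_⟩
  obtain ⟨i, rfl⟩ := hν.2 v
  have e : (Equiv.ofBijective ν hν).symm (ν i) = i := Equiv.ofBijective_symm_apply_apply _ _ _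
  change inc ((Equiv.ofBijective ν hν).symm (ν i)) (s + 0) = c (slot (ν i) s)
  rw [e, add_zero, hinc]

/-- The pairs of edges that become one edge when the nodes `u` and `v` are removed. -/
def throughPairs {n m : ℕ} (inc : Fin n → Fin 4 → Fin m) (u v : Fin n) : List (Fin m × Fin m) :=
  [u, v].flatMap fun x => (List.finRange 4).map fun s => (inc x s, inc x (s + 2))

theorem removeNodes_iso_ofInc {n m n' m' : ℕ} {inc : Fin n → Fin 4 → Fin m} {u v : Fin n}
    (ν : Fin n' → Fin n) (hν : Function.Injective ν) (hν' : ∀ x, (∃ i, ν i = x) ↔ x ≠ u ∧ x ≠ v)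
    (c : Fin m → Fin m') (hc : Function.Surjective c)
    (hE : ∀ e ∈ throughPairs inc u v, c e.1 = c e.2)
    (hinj : ∀ i j, c i = c j → (mergeLabels (throughPairs inc u v) (List.range m)).getD i 0 =
      (mergeLabels (throughPairs inc u v) (List.range m)).getD j 0)
    {inc' : Fin n' → Fin 4 → Fin m'} (hinc : ∀ i s, inc' i s = c (inc (ν i) s)) :
    ((ofInc inc).removeNodes u v).Iso (ofInc inc') := by
  refine iso_ofInc (V := {x : Fin n // x ≠ u ∧ x ≠ v}) (slot := fun x s => inc x.1 s)
    (E := throughPairs inc u v) (fun i j => ?_) (fun i => ⟨ν i, (hν' _).1 ⟨i, rfl⟩⟩)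
    ⟨fun i j h => hν (congrArg Subtype.val h), fun x => ?_⟩ c hc hE hinj hinc
  · simp only [throughPairs, List.mem_flatMap, List.mem_map, List.mem_finRange, true_and,
      List.mem_cons, List.not_mem_nil, or_false, Prod.mk.injEq]
    constructor
    · rintro ⟨x, hx, s, h1, h2⟩; exact ⟨x, hx, s, h1.symm, h2.symm⟩
    · rintro ⟨x, hx, s, h1, h2⟩; exact ⟨x, hx, s, h1.symm, h2.symm⟩
  · obtain ⟨i, hi⟩ := (hν' x.1).2 x.2
    exact ⟨i, Subtype.ext hi⟩

end NodeGraph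

open NodeGraph

theorem parityState_iso_ofInc {w : List GaussLetter} {T : Finset ℕ} {L : List ℕ} {n m : ℕ}
    (hL : evenCrossings w = L.toFinset) (ν : Fin n → ℕ) (hν : Function.Injective ν)
    (hν' : oddCrossings w = Finset.univ.image ν) (c : Fin (w.length + 1) → Fin m)
    (hc : Function.Surjective c) (hE : ∀ e ∈ joinedPairs w L T, c e.1 = c e.2)
    (hinj : ∀ i j, c i = c j →
      (mergeLabels (joinedPairs w L T) (List.range (w.length + 1))).getD i 0 =
      (mergeLabels (joinedPairs w L T) (List.range (w.length + 1))).getD j 0)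
    {inc : Fin n → Fin 4 → Fin m} (hinc : ∀ i s, inc i s = c (slotArc w (ν i) s)) :
    (parityState w T).Iso (ofInc inc) := by
  refine iso_ofInc (slot := fun (a : {a : ℕ // a ∈ oddCrossings w}) s => slotArc w a.1 s)
    (joined_iff_mem_joinedPairs hL) (fun i => ⟨ν i, by rw [hν']; simp⟩)
    ⟨fun i j h => hν (congrArg Subtype.val h), fun x => ?_⟩ c hc hE hinj hinc
  obtain ⟨i, -, hi⟩ := Finset.mem_image.1 (hν' ▸ x.2 : x.1 ∈ Finset.univ.image ν)
  exact ⟨i, Subtype.ext hi⟩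

theorem evenCrossings_knotKS : evenCrossings knotKS.word = {6} := by decide +kernel

theorem oddCrossings_knotKS : oddCrossings knotKS.word = {0, 2, 3, 4} := by decide +kernel

/-- Row `i` of the table lists the edges at the `i`-th of the nodes `0, 2, 3, 4`. -/
theorem parityState_knotKS_iso :
    (parityState knotKS.word {6}).Iso (ofInc (n := 4) (m := 8)
      ![![1, 7, 2, 0], ![4, 0, 5, 1], ![5, 3, 6, 4], ![2, 7, 6, 3]]) :=
  parityState_iso_ofInc (L := [6]) (by decide +kernel) ![0, 2, 3, 4] (by decide +kernel)
    (by decide +kernel) (fun k => [7, 0, 1, 2, 6, 7, 3, 4, 5, 6, 7].getD k 0)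
    (by decide +kernel) (by decide +kernel) (by decide +kernel) (by decide +kernel)

theorem parityState_knotKS_iso' :
    (parityState knotKS.word ∅).Iso (ofInc (n := 4) (m := 8)
      ![![1, 7, 2, 0], ![4, 0, 5, 1], ![5, 3, 6, 4], ![2, 6, 7, 3]]) :=
  parityState_iso_ofInc (L := [6]) (by decide +kernel) ![0, 2, 3, 4] (by decide +kernel)
    (by decide +kernel) (fun k => [7, 0, 1, 2, 7, 6, 3, 4, 5, 6, 7].getD k 0)
    (by decide +kernel) (by decide +kernel) (by decide +kernel) (by decide +kernel)

theorem isIrreducible_parityState_knotKS : (parityState knotKS.word ∅).IsIrreducible := by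
  refine HasNoFramedBigon.isIrreducible
    (parityState_knotKS_iso'.hasNoFramedBigon ?_)
    (parityState_knotKS_iso'.isFourValent (isFourValent_ofInc (by decide +kernel))) ?_
  · exact hasNoFramedBigon_ofInc (by decide +kernel)
  · exact ⟨⟨0, by decide +kernel⟩⟩

theorem freeLoopCount_parityState_knotKS : (parityState knotKS.word ∅).freeLoopCount = 0 :=
  parityState_knotKS_iso'.freeLoopCount_eq_zero (by decide +kernel)

/-- The nodes `0` and `4` are the corners of a bigon, and so are `2` and `3` once the former are
removed. -/
theorem reducesTo_parityState_knotKS :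
    (parityState knotKS.word {6}).ReducesTo NodeGraph.empty.addLoop := by
  have step : ∀ {G H : NodeGraph}, G.ZStep H ∨ G.TwoStep H → G.ReducesTo H :=
    fun h => Relation.ReflTransGen.single h
  have iso : ∀ {G H : NodeGraph}, G.Iso H → G.ReducesTo H := fun h => step (.inl (.inl h))
  refine (iso parityState_knotKS_iso).trans ?_
  refine (step (.inr ⟨isFourValent_ofInc (by decide +kernel), (0 : Fin 4), (3 : Fin 4),
    ⟨(by decide : (0 : Fin 4) ≠ 3), 1, 0, rfl, rfl⟩, rfl⟩)).trans ?_
  refine (iso (removeNodes_iso_ofInc (n' := 2) (m' := 4) ![1, 2] (by decide +kernel)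
    (by decide +kernel) ![0, 1, 1, 0, 2, 3, 1, 0] (by decide +kernel) (by decide +kernel)
    (by decide +kernel) (inc' := ![![2, 0, 3, 1], ![3, 0, 1, 2]]) (by decide +kernel))).trans ?_
  refine (step (.inr ⟨isFourValent_ofInc (by decide +kernel), (0 : Fin 2), (1 : Fin 2),
    ⟨(by decide : (0 : Fin 2) ≠ 1), 1, 0, rfl, rfl⟩, rfl⟩)).trans ?_
  refine (iso (removeNodes_iso_ofInc (n' := 0) (m' := 1) ![] (by decide +kernel)
    (by decide +kernel) (fun _ => 0) (by decide +kernel) (by decide +kernel)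
    (by decide +kernel) (inc' := ![]) (by decide +kernel))).trans ?_
  refine iso ⟨Equiv.equivOfIsEmpty (Fin 0) Empty, Equiv.ofUnique (Fin 1) (Option Empty),
    fun _ => 0, fun v => Fin.elim0 v⟩

/-! ### The parity bracket -/

theorem graphClass_eq_of_step {G H : NodeGraph} (h : G.ZStep H ∨ G.TwoStep H) :
    graphClass G = graphClass H :=
  (Submodule.Quotient.eq _).2 (Submodule.subset_span (.inl ⟨G, H, h, rfl⟩))

theorem NodeGraph.ReducesTo.graphClass_eq {G H : NodeGraph} (h : G.ReducesTo H) :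
    graphClass G = graphClass H := by
  induction h with
  | refl => rfl
  | tail _ h ih => exact ih.trans (graphClass_eq_of_step h)

theorem graphClass_addLoop (G : NodeGraph) :
    graphClass G.addLoop = loopValue • graphClass G := by
  rw [graphClass, graphClass, ← Submodule.Quotient.mk_smul, Finsupp.smul_single, smul_eq_mul,
    mul_one]
  exact (Submodule.Quotient.eq _).2 (Submodule.subset_span (.inr ⟨G, rfl⟩))

theorem parityBracket_knotKS : parityBracket knotKS =
    (LaurentPolynomial.T 1 * loopValue : ℤ[T;T⁻¹]) • graphClass NodeGraph.empty +
      (LaurentPolynomial.T (-1) : ℤ[T;T⁻¹]) • graphClass (parityState knotKS.word ∅) := by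
  have h : ({6} : Finset ℕ).powerset = {{6}, ∅} := by decide
  rw [parityBracket, evenCrossings_knotKS, h, Finset.sum_pair (by decide),
    reducesTo_parityState_knotKS.graphClass_eq, graphClass_addLoop, smul_smul]
  rfl

theorem NodeGraph.zFlip_inc_of_eq (G : NodeGraph) {v x : G.V} (h : x = v) (s : Fin 4) :
    (G.zFlip v).inc x s = G.inc x (-s) :=
  if_pos h

theorem NodeGraph.zFlip_inc_of_ne (G : NodeGraph) {v x : G.V} (h : x ≠ v) (s : Fin 4) :
    (G.zFlip v).inc x s = G.inc x s :=
  if_neg h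

section Virtualization

variable {w : List GaussLetter} (a : ℕ)

theorem crossings_zWord : crossings (zWord a w) = crossings w := by
  rw [crossings, crossings]; exact congrArg _ (labels_zWord a w)

theorem position_zWord (b : ℕ) (o : Bool) :
    position (zWord a w) b o = position w b (if b = a then !o else o) := by
  rw [position, position, zWord, List.findIdx_map]
  congr 1
  funext x
  by_cases hx : x.label = a <;> by_cases hb : b = a <;>
    by_cases hxb : x.label = b <;> simp_all
  all_goals cases x.isOver <;> cases o <;> simp_all

theorem isPositive_zWord (h : IsGaussCode w) (b : ℕ) :
    isPositive (zWord a w) b = isPositive w b := by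
  have h1 : (⟨b, false, true⟩ : GaussLetter) ∈ w ↔ ⟨b, true, true⟩ ∈ w :=
    ⟨fun hb => (h.2 _ hb).1, fun hb => (h.2 _ hb).1⟩
  rw [isPositive, isPositive, List.contains_eq_mem, List.contains_eq_mem, zWord]
  congr 1
  rw [List.mem_map]
  by_cases hb : b = a
  · subst hb
    rw [eq_iff_iff, ← h1]
    constructor
    · rintro ⟨⟨c, o, s⟩, hx, e⟩
      by_cases hc : c = b <;> simp_all
    · exact fun hx => ⟨_, hx, by simp⟩
  · rw [eq_iff_iff]
    constructor
    · rintro ⟨⟨c, o, s⟩, hx, e⟩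
      by_cases hc : c = a <;> simp_all
    · exact fun hx => ⟨_, hx, by simp [hb]⟩

theorem isOddCrossing_zWord (b : ℕ) : IsOddCrossing (zWord a w) b ↔ IsOddCrossing w b := by
  rw [IsOddCrossing, IsOddCrossing, position_zWord, position_zWord]
  by_cases hb : b = a
  · simp [hb, max_comm, min_comm]
  · simp [hb]

theorem oddCrossings_zWord : oddCrossings (zWord a w) = oddCrossings w := by
  rw [oddCrossings, oddCrossings, crossings_zWord]
  exact Finset.filter_congr fun b _ => isOddCrossing_zWord a b

theorem evenCrossings_zWord : evenCrossings (zWord a w) = evenCrossings w := by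
  rw [evenCrossings, evenCrossings, crossings_zWord]
  exact Finset.filter_congr fun b _ => not_congr (isOddCrossing_zWord a b)

theorem length_zWord : (zWord a w).length = w.length := List.length_map _

/-- Virtualization of a crossing reverses the cyclic order of its four slots. -/
theorem slotArc_zWord (h : IsGaussCode w) (b : ℕ) (s : Fin 4) :
    (slotArc (zWord a w) b s).cast (congrArg (· + 1) (length_zWord a)) =
      slotArc w b (if b = a then 1 - s else s) := by
  apply Fin.ext
  simp only [slotArc, Fin.val_cast, Fin.ofNat, position_zWord, isPositive_zWord a h, length_zWord]
  by_cases hb : b = a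
  · simp only [if_pos hb, Bool.not_not]
    fin_cases s <;> rfl
  · simp only [if_neg hb]

theorem smoothingPairs_zWord (h : IsGaussCode w) (b : ℕ) (A : Bool) :
    smoothingPairs (zWord a w) b A = smoothingPairs w b A := by
  rw [smoothingPairs, smoothingPairs, isPositive_zWord a h]

/-- The reversal of the slots maps each of the two smoothings to itself. -/
theorem smoothingPairs_reverse (b : ℕ) (A : Bool) {p : Fin 4 × Fin 4}
    (hp : p ∈ smoothingPairs w b A) : (1 - p.1, 1 - p.2) ∈ smoothingPairs w b A ∨
      (1 - p.2, 1 - p.1) ∈ smoothingPairs w b A := by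
  rw [smoothingPairs] at *
  revert p
  split <;> decide

theorem slotArc_zWord' (h : IsGaussCode w) (b : ℕ) (s : Fin 4) :
    (slotArc w b s).cast (congrArg (· + 1) (length_zWord a).symm) =
      slotArc (zWord a w) b (if b = a then 1 - s else s) := by
  have := slotArc_zWord a h b (if b = a then 1 - s else s)
  have hs : (if b = a then 1 - (if b = a then 1 - s else s) else
      if b = a then 1 - s else s) = s := by
    by_cases hb : b = a <;> simp [hb]
  rw [hs] at this
  rw [← this]
  rfl

/-- A state has the same pieces before and after a virtualization. -/
noncomputable def stateArcZWord (h : IsGaussCode w) (S T : Finset ℕ) :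
    StateArc (zWord a w) S T ≃ StateArc w S T where
  toFun := Quot.lift
    (fun x => Quot.mk _ (x.cast (congrArg (· + 1) (length_zWord a)))) (by
      rintro x y (⟨rfl, rfl⟩ | ⟨b, hb, p, hp, rfl, rfl⟩)
      · exact Quot.sound (.inl ⟨rfl, Fin.ext (length_zWord a)⟩)
      · rw [smoothingPairs_zWord a h] at hp
        rw [slotArc_zWord a h, slotArc_zWord a h]
        by_cases hba : b = a
        · rw [if_pos hba, if_pos hba]
          rcases smoothingPairs_reverse b _ hp with hp | hp
          · exact Quot.sound (.inr ⟨b, hb, _, hp, rfl, rfl⟩)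
          · exact (Quot.sound (.inr ⟨b, hb, _, hp, rfl, rfl⟩)).symm
        · rw [if_neg hba, if_neg hba]
          exact Quot.sound (.inr ⟨b, hb, _, hp, rfl, rfl⟩))
  invFun := Quot.lift
    (fun x => Quot.mk _ (x.cast (congrArg (· + 1) (length_zWord a).symm))) (by
      rintro x y (⟨rfl, rfl⟩ | ⟨b, hb, p, hp, rfl, rfl⟩)
      · exact Quot.sound (.inl ⟨rfl, Fin.ext (length_zWord a).symm⟩)
      · rw [← smoothingPairs_zWord a h] at hp
        rw [slotArc_zWord' a h, slotArc_zWord' a h]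
        by_cases hba : b = a
        · rw [if_pos hba, if_pos hba]
          rcases smoothingPairs_reverse b _ hp with hp | hp
          · exact Quot.sound (.inr ⟨b, hb, _, hp, rfl, rfl⟩)
          · exact (Quot.sound (.inr ⟨b, hb, _, hp, rfl, rfl⟩)).symm
        · rw [if_neg hba, if_neg hba]
          exact Quot.sound (.inr ⟨b, hb, _, hp, rfl, rfl⟩))
  left_inv := by rintro ⟨x⟩; rfl
  right_inv := by rintro ⟨x⟩; rfl

theorem stateArcZWord_mk (h : IsGaussCode w) (S T : Finset ℕ) (b : ℕ) (s : Fin 4) :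
    stateArcZWord a h S T (Quot.mk _ (slotArc (zWord a w) b s)) =
      Quot.mk _ (slotArc w b (if b = a then 1 - s else s)) :=
  congrArg _ (slotArc_zWord a h b s)

theorem graphClass_parityState_zWord (h : IsGaussCode w) (T : Finset ℕ) :
    graphClass (parityState (zWord a w) T) = graphClass (parityState w T) := by
  let f : {b : ℕ // b ∈ oddCrossings (zWord a w)} ≃ {b : ℕ // b ∈ oddCrossings w} :=
    Equiv.subtypeEquivRight fun b => by rw [oddCrossings_zWord]
  let g : StateArc (zWord a w) (evenCrossings (zWord a w)) T ≃ StateArc w (evenCrossings w) T :=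
    (Equiv.cast (by rw [evenCrossings_zWord])).trans (stateArcZWord a h (evenCrossings w) T)
  have hg : ∀ b s, g (Quot.mk _ (slotArc (zWord a w) b s)) =
      Quot.mk _ (slotArc w b (if b = a then 1 - s else s)) := by
    intro b s
    refine Eq.trans ?_ (stateArcZWord_mk a h (evenCrossings w) T b s)
    simp only [g, Equiv.trans_apply]
    congr 1
    generalize_proofs pf
    revert pf
    rw [evenCrossings_zWord]
    exact fun _ => rfl
  by_cases ha : a ∈ oddCrossings w
  · let v : (parityState w T).V := ⟨a, ha⟩
    have iso : (parityState (zWord a w) T).Iso ((parityState w T).zFlip v) := by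
      -- The reversal `s ↦ 1 - s` is the graphical `Z`-move `s ↦ -s` up to a rotation by one slot.
      refine ⟨f, g, fun b => if b.1 = a then -1 else 0, fun b s => ?_⟩
      refine Eq.trans ?_ (hg b.1 s).symm
      by_cases hb : b.1 = a
      · have hf : f b = v := Subtype.ext hb
        have hs : ∀ s : Fin 4, -(s + -1) = 1 - s := by decide
        simp only [if_pos hb]
        refine (NodeGraph.zFlip_inc_of_eq _ hf _).trans ?_
        rw [hs]
        rfl
      · have hf : f b ≠ v := fun e => hb (congrArg Subtype.val e)
        simp only [if_neg hb]
        rw [add_zero]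
        exact NodeGraph.zFlip_inc_of_ne _ hf s
    rw [graphClass_eq_of_step (.inl (.inl iso)), ← graphClass_eq_of_step (.inl (.inr ⟨v, rfl⟩))]
  · refine graphClass_eq_of_step (.inl (.inl ⟨f, g, fun _ => 0, fun b s => ?_⟩))
    refine Eq.trans ?_ (hg b.1 s).symm
    have hb : b.1 ≠ a := fun e => ha (e ▸ (f b).2)
    rw [if_neg hb, add_zero]
    rfl

end Virtualization

theorem VirtualKnotDiagram.ZMove.parityBracket_eq {K K' : VirtualKnotDiagram} (h : K.ZMove K') :
    parityBracket K = parityBracket K' := by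
  obtain ⟨a, h⟩ := h
  rw [parityBracket, parityBracket, h, evenCrossings_zWord]
  exact Finset.sum_congr rfl fun T _ => by rw [graphClass_parityState_zWord a K.valid]

/-! ### The counterexample -/

theorem not_zMoveEquivalent_of_isClassical {K : VirtualKnotDiagram} (hK : K.IsClassical) :
    ¬ ZMoveEquivalent knotKS K := fun h => by
  have := h.smoothingInvariant_eq
  rw [smoothingInvariant_knotKS, hK.smoothingInvariant_eq_zero] at this
  exact one_ne_zero this

theorem not_zMoveEquivalent_unknotDiagram : ¬ ZMoveEquivalent knotKS unknotDiagram := fun h => by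
  have := h.smoothingInvariant_eq
  rw [smoothingInvariant_knotKS] at this
  exact one_ne_zero this

theorem mainTheorem4 :
    -- the Jones polynomial is the unit
    jonesPolynomial knotKS = 1 ∧
    -- one even and four odd crossings
    (evenCrossings knotKS.word).card = 1 ∧ (oddCrossings knotKS.word).card = 4 ∧
    -- the parity bracket is invariant under the Z-move
    (∀ K K' : VirtualKnotDiagram, K.ZMove K' → parityBracket K = parityBracket K') ∧
    -- one state reduces to a loop without nodes
    (parityState knotKS.word (evenCrossings knotKS.word)).ReducesTo NodeGraph.empty.addLoop ∧
    -- the other state is irreducible and has four nodes and no free loop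
    (parityState knotKS.word ∅).IsIrreducible ∧
    Nat.card (parityState knotKS.word ∅).V = 4 ∧
    (parityState knotKS.word ∅).freeLoopCount = 0 ∧
    -- the value of the parity bracket
    parityBracket knotKS =
      (LaurentPolynomial.T 1 * loopValue : LaurentPolynomial ℤ) • graphClass NodeGraph.empty +
        (LaurentPolynomial.T (-1) : LaurentPolynomial ℤ) •
          graphClass (parityState knotKS.word ∅) ∧
    -- no classical knot is Z-move equivalent to KS, in particular the unknot is not
    (∀ K : VirtualKnotDiagram, K.IsClassical → ¬ ZMoveEquivalent knotKS K) ∧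
    ¬ ZMoveEquivalent knotKS unknotDiagram ∧
    -- the Z-move conjecture fails
    ¬ (∀ K : VirtualKnotDiagram, jonesPolynomial K = 1 → ZMoveEquivalent K unknotDiagram) := by
  refine ⟨jonesPolynomial_knotKS, by rw [evenCrossings_knotKS]; rfl,
    by rw [oddCrossings_knotKS]; rfl, fun _ _ h => h.parityBracket_eq,
    by rw [evenCrossings_knotKS]; exact reducesTo_parityState_knotKS,
    isIrreducible_parityState_knotKS, parityState_knotKS_iso'.natCard_V.trans (Nat.card_fin 4),
    freeLoopCount_parityState_knotKS, parityBracket_knotKS,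
    fun _ => not_zMoveEquivalent_of_isClassical, not_zMoveEquivalent_unknotDiagram,
    fun h => not_zMoveEquivalent_unknotDiagram (h _ jonesPolynomial_knotKS)⟩
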